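/- Let $A$, $B$ be $W^*$-algebras. An $A$-$B$ $W^*$-correspondence is a self-dual right Hilbert $C^*$-module over $B$ with a unital normal $*$-homomorphism from $A$ into its adjointable operators; an $A$-$A$ $W^*$-correspondence $E$ is written $(E,A)$. Let $\overline{\otimes}$ denote the $W^*$-tensor product (the self-dual completion of the balanced interior tensor product). Let $(E,A)$ and $(F,B)$ be $W^*$-correspondences that are weakly Morita equivalent via $X$: $X$ is an $A$-$B$ $W^*$-equivalence bimodule (an $A$-$B$ $W^*$-correspondence, self-dual also as a left Hilbert $A$-module, with ${}_A\langle x,y\rangle z=x\langle y,z\rangle_B$ and with both inner products weak$^*$-full), and $W:E\overline{\otimes}_A X\to X\overline{\otimes}_B F$ is an isomorphism of $A$-$B$ $W^*$-correspondences. Let $\sigma:B\to B(H)$ be a normal $*$-representation on a Hilbert space $H$. Write $F\otimes_\sigma H$ for the Hilbert space completion of the algebraic tensor product under $\langle x\otimes h,y\otimes k\rangle=\langle h,\sigma(\langle x,y\rangle)k\rangle$, let $(F^\sigma)^*$ be the space of bounded operators $\eta^*:F\otimes_\sigma H\to H$ with $\eta^*(b\otimes I_H)=\sigma(b)\eta^*$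 for all $b\in B$, where $b\otimes I_H: x\otimes h\mapsto bx\otimes h$, and let $\mathbb D((F^\sigma)^*)$ be its open unit ball for the operator norm. Let $\sigma$-Covrep$F$ be the category whose objects are the points of $\mathbb D((F^\sigma)^*)$ and whose morphisms $\eta_1^*\to\eta_2^*$ are the biholomorphic automorphisms $g$ of $\mathbb D((F^\sigma)^*)$ with $g(\eta_1^*)=\eta_2^*$, with composition of maps. Let $\sigma^X:A\to B(X\otimes_\sigma H)$, $\sigma^X(a)(x\otimes h)=ax\otimes h$, be the induced representation, and define $\sigma^X$-Covrep$E$ in the same way from $\mathbb D((E^{\sigma^X})^*)$. Then $\sigma$-Covrep$F$ and $\sigma^X$-Covrep$E$ are equivalent categories. More precisely, there is an equivalence of categories $\mathscr F:\sigma\text{-Covrep}F\to\sigma^X\text{-Covrep}E$ which on objects is $$\eta^*\mapsto{\eta^*}^X:=(I_X\otimes\eta^*)(W\otimes I_H),$$ where $E\otimes_{\sigma^X}(X\otimes_\sigma H)$ is identified with $(E\overline{\otimes}_AX)\otimes_\sigma H$ and $(X\overline{\otimes}_BF)\otimes_\sigma H$ with $X\otimes(F\otimes_\sigma H)$ in the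 canonical way, and which maps a morphism $g$ to a morphism $\mathscr F(g)$ with $\mathscr F(g)({\zeta^*}^X)=(g(\zeta^*))^X$ for all $\zeta^*\in\mathbb D((F^\sigma)^*)$. -/

import Mathlib

open scoped TensorProduct RightActions

noncomputable section

set_option linter.unusedSectionVars false

namespace WStarMorita

open CategoryTheory

/-! ### Right Hilbert modules -/

/-- A right (pre-)Hilbert C⋆-module `E` over a C⋆-algebra `B`: the `B`-valued inner product is
conjugate linear in the first and linear in the second variable, and induces the norm of `E`.
(Mathlib's `CStarModule` is the notion for left actions.)  Completeness is required separately. -/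
class RightHilbertModule (B E : Type*) [CStarAlgebra B] [PartialOrder B]
    [NormedAddCommGroup E] [NormedSpace ℂ E] [Module Bᵐᵒᵖ E] where
  /-- the inner product -/
  ip : E → E → B
  ip_add_right : ∀ x y z, ip x (y + z) = ip x y + ip x z
  ip_smul_right : ∀ (c : ℂ) x y, ip x (c • y) = c • ip x y
  ip_op_smul_right : ∀ x y (b : B), ip x (y <• b) = ip x y * b
  star_ip : ∀ x y, star (ip x y) = ip y x
  ip_self_nonneg : ∀ x, 0 ≤ ip x x
  norm_sq_eq : ∀ x, ‖x‖ ^ 2 = ‖ip x x‖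

open RightHilbertModule (ip)

section Basic

variable {B E : Type*} [CStarAlgebra B] [PartialOrder B]
  [NormedAddCommGroup E] [NormedSpace ℂ E] [Module Bᵐᵒᵖ E] [RightHilbertModule B E]

lemma ip_add_right (x y z : E) : (ip x (y + z) : B) = ip x y + ip x z :=
  RightHilbertModule.ip_add_right x y z

lemma ip_smul_right (c : ℂ) (x y : E) : (ip x (c • y) : B) = c • ip x y :=
  RightHilbertModule.ip_smul_right c x y

lemma star_ip (x y : E) : star (ip x y : B) = ip y x := RightHilbertModule.star_ip x y

lemma ip_add_left (x y z : E) : (ip (x + y) z : B) = ip x z + ip y z := by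
  rw [← star_ip z (x + y), ip_add_right, star_add, star_ip, star_ip]

lemma ip_smul_left (c : ℂ) (x y : E) : (ip (c • x) y : B) = star c • ip x y := by
  rw [← star_ip y, ip_smul_right, star_smul, star_ip]

variable (B E) in
/-- The inner product as a sesquilinear map. -/
def ipₛₗ : E →ₗ⋆[ℂ] E →ₗ[ℂ] B :=
  LinearMap.mk₂'ₛₗ (starRingEnd ℂ) (RingHom.id ℂ) (fun x y => (ip x y : B))
    ip_add_left ip_smul_left ip_add_right ip_smul_right

lemma ip_sum_right {ι : Type*} (s : Finset ι) (x : E) (y : ι → E) :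
    (ip x (∑ i ∈ s, y i) : B) = ∑ i ∈ s, ip x (y i) := map_sum (ipₛₗ B E x) y s

lemma ip_sum_left {ι : Type*} (s : Finset ι) (x : ι → E) (y : E) :
    (ip (∑ i ∈ s, x i) y : B) = ∑ i ∈ s, ip (x i) y := by
  rw [← star_ip, ip_sum_right, star_sum]
  exact Finset.sum_congr rfl fun i _ => star_ip _ _

lemma ip_op_smul_right (x y : E) (b : B) : (ip x (y <• b) : B) = ip x y * b :=
  RightHilbertModule.ip_op_smul_right x y b

lemma ip_op_smul_left (x y : E) (b : B) : (ip (x <• b) y : B) = star b * ip x y := by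
  rw [← star_ip, ip_op_smul_right, star_mul, star_ip]

variable (B) in
lemma ext_ip {x y : E} (h : ∀ z, (ip z x : B) = ip z y) : x = y := by
  have h0 : (ip (x - y) (x - y) : B) = 0 := by
    have h1 := h (x - y)
    have h2 : (ip (x - y) (x - y) : B) = ip (x - y) x - ip (x - y) y :=
      map_sub (ipₛₗ B E (x - y)) x y
    rw [h2, h1, sub_self]
  have h3 := RightHilbertModule.norm_sq_eq (B := B) (x - y)
  rw [h0, norm_zero] at h3
  exact sub_eq_zero.mp (norm_eq_zero.mp (pow_eq_zero_iff (two_ne_zero) |>.mp h3))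

/-- The decomposition of a self-adjoint element into its positive and negative part. -/
lemma exists_posPart_negPart {M : Type*} [NonUnitalCStarAlgebra M] [PartialOrder M]
    [StarOrderedRing M] (m : M) (hm : IsSelfAdjoint m) :
    ∃ r s n : M, n = star s * s ∧ star n = n ∧ m = star r * r - n ∧ star r * r * n = 0 := by
  obtain ⟨s, hs⟩ := CStarAlgebra.nonneg_iff_eq_star_mul_self.mp (CFC.negPart_nonneg m)
  obtain ⟨r, hr⟩ := CStarAlgebra.nonneg_iff_eq_star_mul_self.mp (CFC.posPart_nonneg m)
  refine ⟨r, s, m⁻, hs, (CFC.negPart_nonneg m).isSelfAdjoint, ?_, ?_⟩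
  · rw [← hr, CFC.posPart_sub_negPart m hm]
  · rw [← hr, CFC.posPart_mul_negPart m]

/-- Gram matrices are positive: they are of the form `R⋆ R`. -/
lemma exists_gram_factor [StarOrderedRing B] {ι : Type*} [Fintype ι] (x : ι → E) :
    ∃ R : ι → ι → B, ∀ i j, (ip (x i) (x j) : B) = ∑ k, star (R k i) * R k j := by
  classical
  let M : CStarMatrix ι ι B := CStarMatrix.ofMatrix fun i j => ip (x i) (x j)
  have hMe : ∀ i j, M i j = ip (x i) (x j) := fun _ _ => rfl
  have hM : IsSelfAdjoint M := by
    ext i j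
    rw [CStarMatrix.star_apply, hMe, hMe, star_ip]
  obtain ⟨R, S, N, hS, hNsa, hdec, hpn⟩ := exists_posPart_negPart M hM
  have hNMN : N * M * N = -(N * N * N) := by
    have : M * N = -(N * N) := by rw [hdec, sub_mul, hpn, zero_sub]
    rw [mul_assoc, this, mul_neg, mul_assoc]
  have hcube : N * N * N = star (S * N) * (S * N) := by
    rw [star_mul, hNsa, mul_assoc N (star S), ← mul_assoc (star S), ← hS, mul_assoc]
  have hent : ∀ i j, star (N i j) = N j i := fun i j => by
    rw [← CStarMatrix.star_apply, hNsa]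
  have hSN : S * N = 0 := by
    have key : ∀ k i, (S * N) i k = 0 := by
      intro k
      have h1 : (N * M * N) k k = ip (∑ j, x j <• N j k) (∑ j, x j <• N j k) := by
        rw [ip_sum_left]
        simp only [ip_sum_right, ip_op_smul_left, ip_op_smul_right, CStarMatrix.mul_apply,
          Finset.sum_mul, hent, hMe]
        rw [Finset.sum_comm]
      have h2 : (N * N * N) k k = ∑ i, star ((S * N) i k) * (S * N) i k := by
        rw [hcube, CStarMatrix.mul_apply]
        simp [CStarMatrix.star_apply]
      have h3 : 0 ≤ (N * M * N) k k := by
        rw [h1]; exact RightHilbertModule.ip_self_nonneg _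
      have h4 : 0 ≤ ∑ i, star ((S * N) i k) * (S * N) i k :=
        Finset.sum_nonneg fun i _ => star_mul_self_nonneg _
      have h5 : ∑ i, star ((S * N) i k) * (S * N) i k = 0 := by
        refine le_antisymm ?_ h4
        rw [hNMN, CStarMatrix.neg_apply, h2] at h3
        exact neg_nonneg.mp h3
      intro i
      have h6 := (Finset.sum_eq_zero_iff_of_nonneg
        (fun i _ => star_mul_self_nonneg ((S * N) i k))).mp h5 i (Finset.mem_univ i)
      exact CStarRing.star_mul_self_eq_zero_iff _ |>.mp h6
    ext i k
    exact key k i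
  have hNN : N * N = 0 := by
    rw [show N * N = star S * (S * N) by rw [← mul_assoc, ← hS], hSN, mul_zero]
  have hNz : N = 0 := by
    have : star N * N = 0 := by rw [hNsa, hNN]
    exact CStarRing.star_mul_self_eq_zero_iff _ |>.mp this
  have hMR : M = star R * R := by rw [hdec, hNz, sub_zero]
  refine ⟨fun k j => R k j, fun i j => ?_⟩
  rw [← hMe, hMR, CStarMatrix.mul_apply]
  simp [CStarMatrix.star_apply]

end Basic

/-! ### W⋆-modules, W⋆-correspondences, W⋆-equivalence bimodules -/

/-- Self-duality: every bounded `B`-module map `E → B` is of the form `⟨y, ·⟩`. -/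
def IsSelfDual (B E : Type*) [CStarAlgebra B] [PartialOrder B]
    [NormedAddCommGroup E] [NormedSpace ℂ E] [Module Bᵐᵒᵖ E] [RightHilbertModule B E] : Prop :=
  ∀ f : E →L[ℂ] B, (∀ x (b : B), f (x <• b) = f x * b) → ∃ y, ∀ x, f x = ip y x

open scoped ComplexOrder in
/-- The normal positive functionals of a W⋆-algebra: the positive functionals that preserve the
suprema of bounded increasing nets.  Their linear span is the predual. -/
def NormalFunctional (B : Type*) [CStarAlgebra B] [PartialOrder B] : Type _ :=
  {ω : B →ₚ[ℂ] ℂ // ScottContinuous ω}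

/-- The weak-⋆ (ultraweak) topology of a W⋆-algebra. -/
abbrev weakStarTopology (B : Type*) [CStarAlgebra B] [PartialOrder B] : TopologicalSpace B :=
  ⨅ ω : NormalFunctional B, TopologicalSpace.induced (fun b => ω.1 b) inferInstance

/-- The weak-⋆ (ultraweak) topology of a W⋆-module, defined by the functionals
`x ↦ ω ⟨y, x⟩` with `y ∈ E` and `ω` normal. -/
abbrev moduleWeakStarTopology (B E : Type*) [CStarAlgebra B] [PartialOrder B]
    [NormedAddCommGroup E] [NormedSpace ℂ E] [Module Bᵐᵒᵖ E] [RightHilbertModule B E] :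
    TopologicalSpace E :=
  ⨅ (ω : NormalFunctional B) (y : E),
    TopologicalSpace.induced (fun x => ω.1 (ip y x)) inferInstance

/-- An `A`-`B` W⋆-correspondence: a self-dual right Hilbert `B`-module `E` with a unital normal
⋆-homomorphism from `A` to the adjointable operators of `E`, written as a left action.
Normality means that `a ↦ ⟨x, a x⟩` preserves suprema of bounded increasing nets for all `x`,
which is normality for the W⋆-algebra of adjointable operators. A W⋆-correspondence `(E, A)` is
an `A`-`A` W⋆-correspondence. -/
class WStarCorrespondence (A B E : Type*) [CStarAlgebra A] [PartialOrder A]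
    [CStarAlgebra B] [PartialOrder B] [NormedAddCommGroup E] [NormedSpace ℂ E]
    [Module A E] [Module Bᵐᵒᵖ E] [RightHilbertModule B E] : Prop where
  complete : CompleteSpace E
  selfDual : IsSelfDual B E
  smul_smul_complex : ∀ (c : ℂ) (a : A) (x : E), (c • a) • x = c • (a • x)
  ip_act_left : ∀ (a : A) (x y : E), (ip (a • x) y : B) = ip x (star a • y)
  normal : ∀ x : E, ScottContinuous fun a : A => (ip x (a • x) : B)

/-- The data turning an `A`-`B` W⋆-correspondence `X` into a W⋆-equivalence bimodule: an
`A`-valued inner product (linear in the first variable) for which `X` is a self-dual left Hilbert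
`A`-module, compatible with the `B`-valued one, both inner products being weak-⋆ full. -/
structure EquivalenceBimodule (A B X : Type*) [CStarAlgebra A] [PartialOrder A]
    [CStarAlgebra B] [PartialOrder B] [NormedAddCommGroup X] [NormedSpace ℂ X]
    [Module A X] [Module Bᵐᵒᵖ X] [RightHilbertModule B X] [WStarCorrespondence A B X] where
  /-- the `A`-valued inner product -/
  lip : X → X → A
  lip_add_left : ∀ x y z, lip (x + y) z = lip x z + lip y z
  lip_smul_left : ∀ (c : ℂ) x y, lip (c • x) y = c • lip x y
  lip_act_left : ∀ (a : A) x y, lip (a • x) y = a * lip x y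
  star_lip : ∀ x y, star (lip x y) = lip y x
  lip_self_nonneg : ∀ x, 0 ≤ lip x x
  norm_sq_eq_lip : ∀ x, ‖x‖ ^ 2 = ‖lip x x‖
  lip_op_smul_left : ∀ x y (b : B), lip (x <• b) y = lip x (y <• star b)
  lip_smul : ∀ x y z, lip x y • z = x <• (ip y z : B)
  left_selfDual : ∀ f : X →L[ℂ] A, (∀ (a : A) x, f (a • x) = a * f x) → ∃ y, ∀ x, f x = lip x y
  left_full : @Dense A (weakStarTopology A) (Submodule.span ℂ {a | ∃ x y, lip x y = a} : Set A)
  right_full : @Dense B (weakStarTopology B)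
    (Submodule.span ℂ {b | ∃ x y : X, (ip x y : B) = b} : Set B)

/-- `IsWStarTensor C A B t` says that the `C`-`B` W⋆-correspondence `Z`, with `t e x` in the role of
`e ⊗ x`, is the W⋆-tensor product over `A` of a `C`-`A` W⋆-correspondence `E` and an `A`-`B`
W⋆-correspondence `X`, i.e. the self-dual completion of their balanced interior tensor product:
the elementary tensors have the interior tensor inner product, and their span is weak-⋆ dense in
the self-dual module `Z`. This determines `(Z, t)` up to a unique isomorphism. -/
structure IsWStarTensor (C A B : Type*) {E X Z : Type*}
    [CStarAlgebra C] [PartialOrder C] [CStarAlgebra A] [PartialOrder A]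
    [CStarAlgebra B] [PartialOrder B]
    [NormedAddCommGroup E] [NormedSpace ℂ E] [Module C E] [Module Aᵐᵒᵖ E]
    [RightHilbertModule A E] [WStarCorrespondence C A E]
    [NormedAddCommGroup X] [NormedSpace ℂ X] [Module A X] [Module Bᵐᵒᵖ X]
    [RightHilbertModule B X] [WStarCorrespondence A B X]
    [NormedAddCommGroup Z] [NormedSpace ℂ Z] [Module C Z] [Module Bᵐᵒᵖ Z]
    [RightHilbertModule B Z] [WStarCorrespondence C B Z]
    (t : E →ₗ[ℂ] X →ₗ[ℂ] Z) : Prop where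
  balanced : ∀ e (a : A) x, t (e <• a) x = t e (a • x)
  act_left : ∀ (c : C) e x, t (c • e) x = c • t e x
  act_right : ∀ e x (b : B), t e (x <• b) = t e x <• b
  ip_tmul : ∀ e e' x x', (ip (t e x) (t e' x') : B) = ip x ((ip e e' : A) • x')
  dense : @Dense Z (moduleWeakStarTopology B Z)
    (Submodule.span ℂ {z | ∃ e x, t e x = z} : Set Z)

/-- Isomorphisms of `A`-`B` W⋆-correspondences: bijective bimodule maps preserving the inner
product. -/
structure CorrespondenceIso (A B Z₁ Z₂ : Type*) [CStarAlgebra A] [PartialOrder A]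
    [CStarAlgebra B] [PartialOrder B]
    [NormedAddCommGroup Z₁] [NormedSpace ℂ Z₁] [Module A Z₁] [Module Bᵐᵒᵖ Z₁]
    [RightHilbertModule B Z₁]
    [NormedAddCommGroup Z₂] [NormedSpace ℂ Z₂] [Module A Z₂] [Module Bᵐᵒᵖ Z₂]
    [RightHilbertModule B Z₂] extends Z₁ ≃ₗ[ℂ] Z₂ where
  map_act_left : ∀ (a : A) z, toFun (a • z) = a • toFun z
  map_act_right : ∀ (b : B) z, toFun (z <• b) = toFun z <• b
  map_ip : ∀ z z', (ip (toFun z) (toFun z') : B) = ip z z'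

/-! ### The Hilbert space `E ⊗_σ H` -/

section Ind

variable {B E H : Type*} [CStarAlgebra B] [PartialOrder B]
  [NormedAddCommGroup E] [NormedSpace ℂ E] [Module Bᵐᵒᵖ E] [RightHilbertModule B E]
  [NormedAddCommGroup H] [InnerProductSpace ℂ H] [CompleteSpace H]

set_option linter.unusedVariables false in
/-- The algebraic tensor product of a right Hilbert `B`-module `E` and the space `H` of a
representation `σ` of `B`, to be equipped with the semi-inner product
`⟨x ⊗ h, y ⊗ k⟩ = ⟨h, σ ⟨x, y⟩ k⟩`. -/
@[nolint unusedArguments]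
def IndPre (E : Type*) [NormedAddCommGroup E] [NormedSpace ℂ E]
    (σ : B →⋆ₙₐ[ℂ] (H →L[ℂ] H)) : Type _ := E ⊗[ℂ] H

instance (σ : B →⋆ₙₐ[ℂ] (H →L[ℂ] H)) : AddCommGroup (IndPre E σ) :=
  inferInstanceAs (AddCommGroup (E ⊗[ℂ] H))

instance (σ : B →⋆ₙₐ[ℂ] (H →L[ℂ] H)) : Module ℂ (IndPre E σ) :=
  inferInstanceAs (Module ℂ (E ⊗[ℂ] H))

variable (σ : B →⋆ₙₐ[ℂ] (H →L[ℂ] H))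

/-- The elementary tensors. -/
def preTmul : E →ₗ[ℂ] H →ₗ[ℂ] IndPre E σ := TensorProduct.mk ℂ E H

/-- Linear maps out of the algebraic tensor product. -/
def preLift {M : Type*} [AddCommGroup M] [Module ℂ M] (f : E →ₗ[ℂ] H →ₗ[ℂ] M) :
    IndPre E σ →ₗ[ℂ] M := TensorProduct.lift f

@[simp]
lemma preLift_tmul {M : Type*} [AddCommGroup M] [Module ℂ M] (f : E →ₗ[ℂ] H →ₗ[ℂ] M)
    (x : E) (h : H) : preLift σ f (preTmul σ x h) = f x h := rfl

variable {σ} in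
lemma pre_exists_sum (u : IndPre E σ) :
    ∃ (n : ℕ) (x : Fin n → E) (h : Fin n → H), u = ∑ i, preTmul σ (x i) (h i) :=
  TensorProduct.exists_sum_tmul_eq u

variable {σ} in
@[elab_as_elim]
lemma pre_induction {p : IndPre E σ → Prop} (u : IndPre E σ) (h0 : p 0)
    (ht : ∀ x h, p (preTmul σ x h)) (ha : ∀ u v, p u → p v → p (u + v)) : p u :=
  TensorProduct.induction_on u h0 ht ha

/-- The semi-inner product on the algebraic tensor product. -/
def preForm : IndPre E σ →ₗ⋆[ℂ] IndPre E σ →ₗ[ℂ] ℂ :=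
  TensorProduct.lift (LinearMap.mk₂'ₛₗ (starRingEnd ℂ) (starRingEnd ℂ)
    (fun (x : E) (h : H) => preLift σ (LinearMap.mk₂ ℂ
      (fun (y : E) (k : H) => inner ℂ h (σ (ip x y) k))
      (fun y y' k => by simp [ip_add_right])
      (fun c y k => by simp [ip_smul_right])
      (fun y k k' => by simp)
      (fun c y k => by simp)))
    (fun x x' h => by
      refine TensorProduct.ext' fun y k => ?_
      change inner ℂ h (σ (ip (x + x') y) k) = inner ℂ h (σ (ip x y) k) + inner ℂ h (σ (ip x' y) k)
      simp [ip_add_left])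
    (fun c x h => by
      refine TensorProduct.ext' fun y k => ?_
      change inner ℂ h (σ (ip (c • x) y) k) = star c * inner ℂ h (σ (ip x y) k)
      simp [ip_smul_left])
    (fun x h h' => by
      refine TensorProduct.ext' fun y k => ?_
      change inner ℂ (h + h') (σ (ip x y) k) = inner ℂ h (σ (ip x y) k) + inner ℂ h' (σ (ip x y) k)
      simp)
    (fun c x h => by
      refine TensorProduct.ext' fun y k => ?_
      change inner ℂ (c • h) (σ (ip x y) k) = star c * inner ℂ h (σ (ip x y) k)
      simp [mul_comm]))

@[simp]
lemma preForm_tmul (x y : E) (h k : H) :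
    preForm σ (preTmul σ x h) (preTmul σ y k) = inner ℂ h (σ (ip x y) k) := rfl

lemma preForm_conj (u v : IndPre E σ) : starRingEnd ℂ (preForm σ v u) = preForm σ u v := by
  induction u using pre_induction with
  | h0 => simp
  | ha u u' hu hu' => simp [hu, hu']
  | ht x h =>
    induction v using pre_induction with
    | h0 => simp
    | ha v v' hv hv' => simp [hv, hv']
    | ht y k =>
      rw [preForm_tmul, preForm_tmul, inner_conj_symm, ← star_ip y x, map_star,
        ContinuousLinearMap.star_eq_adjoint, ContinuousLinearMap.adjoint_inner_right]

lemma preForm_sum_eq {n : ℕ} {x : Fin n → E} {R : Fin n → Fin n → B}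
    (hR : ∀ i j, (ip (x i) (x j) : B) = ∑ k, star (R k i) * R k j) (h : Fin n → H) :
    preForm σ (∑ i, preTmul σ (x i) (h i)) (∑ i, preTmul σ (x i) (h i)) =
      ((∑ k, ‖∑ j, σ (R k j) (h j)‖ ^ 2 : ℝ) : ℂ) := by
  have h1 : ∀ k, ((‖∑ j, σ (R k j) (h j)‖ ^ 2 : ℝ) : ℂ) =
      inner ℂ (∑ j, σ (R k j) (h j)) (∑ j, σ (R k j) (h j)) := fun k => by
    rw [inner_self_eq_norm_sq_to_K]; simp
  have h2 : ∀ i j k, inner ℂ (h i) (σ (star (R k i) * R k j) (h j)) =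
      inner ℂ (σ (R k i) (h i)) (σ (R k j) (h j)) := fun i j k => by
    rw [map_mul, map_star, ContinuousLinearMap.star_eq_adjoint, ContinuousLinearMap.mul_def,
      ContinuousLinearMap.comp_apply, ContinuousLinearMap.adjoint_inner_right]
  have h3 : ∀ i j, inner ℂ (h i) (σ (ip (x i) (x j)) (h j)) =
      ∑ k, inner ℂ (σ (R k i) (h i)) (σ (R k j) (h j)) := fun i j => by
    rw [hR, map_sum, sum_apply, inner_sum]
    exact Finset.sum_congr rfl fun k _ => h2 i j k
  rw [Complex.ofReal_sum]
  simp only [h1, sum_inner, inner_sum, map_sum, LinearMap.sum_apply, preForm_tmul, h3]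
  rw [Finset.sum_comm]
  conv_lhs => enter [2, i]; rw [Finset.sum_comm]
  rw [Finset.sum_comm]
  refine Finset.sum_congr rfl fun i _ => ?_
  rw [Finset.sum_comm]

variable [StarOrderedRing B]

lemma preForm_self_nonneg (u : IndPre E σ) : 0 ≤ (preForm σ u u).re := by
  obtain ⟨n, x, h, rfl⟩ := pre_exists_sum u
  obtain ⟨R, hR⟩ := exists_gram_factor (B := B) x
  rw [preForm_sum_eq σ hR h, Complex.ofReal_re]
  positivity

/-- The semi-inner product of the algebraic tensor product. -/
abbrev preCore : PreInnerProductSpace.Core ℂ (IndPre E σ) where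
  inner u v := preForm σ u v
  conj_inner_symm u v := preForm_conj σ u v
  re_inner_nonneg u := preForm_self_nonneg σ u
  add_left u v w := by simp
  smul_left u v c := by simp

instance : SeminormedAddCommGroup (IndPre E σ) :=
  InnerProductSpace.Core.toSeminormedAddCommGroup (c := preCore σ)

instance : InnerProductSpace ℂ (IndPre E σ) := InnerProductSpace.ofCore (preCore σ)

lemma pre_inner_def (u v : IndPre E σ) : inner ℂ u v = preForm σ u v := rfl

lemma pre_norm_sq (u : IndPre E σ) : ‖u‖ ^ 2 = (preForm σ u u).re :=
  (norm_sq_eq_re_inner (𝕜 := ℂ) u)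

variable (E) in
/-- The Hilbert space `E ⊗_σ H`: the Hausdorff completion of the algebraic tensor product for
`⟨x ⊗ h, y ⊗ k⟩ = ⟨h, σ ⟨x, y⟩ k⟩`. -/
def Ind : Type _ := UniformSpace.Completion (IndPre E σ)

instance : NormedAddCommGroup (Ind E σ) :=
  inferInstanceAs (NormedAddCommGroup (UniformSpace.Completion (IndPre E σ)))

instance : InnerProductSpace ℂ (Ind E σ) :=
  inferInstanceAs (InnerProductSpace ℂ (UniformSpace.Completion (IndPre E σ)))

instance : CompleteSpace (Ind E σ) :=
  inferInstanceAs (CompleteSpace (UniformSpace.Completion (IndPre E σ)))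

variable (E) in
/-- The canonical map from the algebraic tensor product to its completion. -/
def toInd : IndPre E σ →ₗᵢ[ℂ] Ind E σ :=
  (UniformSpace.Completion.toComplₗᵢ : IndPre E σ →ₗᵢ[ℂ] UniformSpace.Completion (IndPre E σ))

lemma inner_toInd (u v : IndPre E σ) :
    inner ℂ (toInd E σ u) (toInd E σ v) = preForm σ u v :=
  UniformSpace.Completion.inner_coe u v

variable {σ} in
@[elab_as_elim]
lemma ind_induction {p : Ind E σ → Prop} (ξ : Ind E σ) (hp : IsClosed {ξ | p ξ})
    (ih : ∀ u, p (toInd E σ u)) : p ξ :=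
  UniformSpace.Completion.induction_on (α := IndPre E σ) ξ hp ih

variable {σ} in
@[elab_as_elim]
lemma ind_induction₂ {E' H' B' : Type*} [CStarAlgebra B'] [PartialOrder B'] [StarOrderedRing B']
    [NormedAddCommGroup E'] [NormedSpace ℂ E'] [Module B'ᵐᵒᵖ E'] [RightHilbertModule B' E']
    [NormedAddCommGroup H'] [InnerProductSpace ℂ H'] [CompleteSpace H']
    {σ' : B' →⋆ₙₐ[ℂ] (H' →L[ℂ] H')} {p : Ind E σ → Ind E' σ' → Prop}
    (ξ : Ind E σ) (ζ : Ind E' σ') (hp : IsClosed {q : Ind E σ × Ind E' σ' | p q.1 q.2})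
    (ih : ∀ u v, p (toInd E σ u) (toInd E' σ' v)) : p ξ ζ :=
  UniformSpace.Completion.induction_on₂ (α := IndPre E σ) (β := IndPre E' σ') ξ ζ hp ih

/-- The elementary tensor `x ⊗ h` in `E ⊗_σ H`. -/
def tmul (x : E) (h : H) : Ind E σ := toInd E σ (preTmul σ x h)

lemma inner_tmul_tmul (x y : E) (h k : H) :
    inner ℂ (tmul σ x h) (tmul σ y k) = inner ℂ h (σ (ip x y) k) := by
  rw [tmul, tmul, inner_toInd, preForm_tmul]

/-- Continuous linear maps on `E ⊗_σ H` agreeing on elementary tensors are equal. -/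
lemma ind_ext {M : Type*} [NormedAddCommGroup M] [NormedSpace ℂ M] {S T : Ind E σ →L[ℂ] M}
    (h : ∀ x k, S (tmul σ x k) = T (tmul σ x k)) : S = T := by
  ext v
  induction v using ind_induction with
  | hp => apply isClosed_eq <;> fun_prop
  | ih u =>
    induction u using pre_induction with
    | h0 => simp only [map_zero]
    | ht x k => exact h x k
    | ha u v hu hv => simp only [map_add, hu, hv]

/-- The bounded operator on `E ⊗_σ H` determined by a bilinear map on `E × H`. -/
def indLift {M : Type*} [NormedAddCommGroup M] [NormedSpace ℂ M] [CompleteSpace M]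
    (f : E →ₗ[ℂ] H →ₗ[ℂ] M) (C : ℝ) (hC : ∀ u, ‖preLift σ f u‖ ≤ C * ‖u‖) : Ind E σ →L[ℂ] M :=
  (((preLift σ f).mkContinuous C hC).fromCompletion :
    UniformSpace.Completion (IndPre E σ) →L[ℂ] M)

lemma indLift_toInd {M : Type*} [NormedAddCommGroup M] [NormedSpace ℂ M] [CompleteSpace M]
    (f : E →ₗ[ℂ] H →ₗ[ℂ] M) (C : ℝ) (hC : ∀ u, ‖preLift σ f u‖ ≤ C * ‖u‖) (u : IndPre E σ) :
    indLift σ f C hC (toInd E σ u) = preLift σ f u :=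
  ContinuousLinearMap.fromCompletion_apply_coe ((preLift σ f).mkContinuous C hC) u

@[simp]
lemma indLift_tmul {M : Type*} [NormedAddCommGroup M] [NormedSpace ℂ M] [CompleteSpace M]
    (f : E →ₗ[ℂ] H →ₗ[ℂ] M) (C : ℝ) (hC : ∀ u, ‖preLift σ f u‖ ≤ C * ‖u‖) (x : E) (h : H) :
    indLift σ f C hC (tmul σ x h) = f x h := by
  rw [tmul, indLift_toInd, preLift_tmul]

lemma le_mul_of_sq {a b c : ℝ} (hb : 0 ≤ b) (hc : 0 ≤ c) (h : a ^ 2 ≤ c ^ 2 * b ^ 2) :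
    a ≤ c * b := by
  rw [← mul_pow] at h
  exact le_of_sq_le_sq h (by positivity)

/-! #### The operator `I_E ⊗ η` -/

section IndMap

variable {K : Type*} [NormedAddCommGroup K] [InnerProductSpace ℂ K] [CompleteSpace K]
  {σ} {ρ : B →⋆ₙₐ[ℂ] (K →L[ℂ] K)}

/-- `x, h ↦ x ⊗ η h`. -/
def indMapBilin (ρ : B →⋆ₙₐ[ℂ] (K →L[ℂ] K)) (η : H →L[ℂ] K) : E →ₗ[ℂ] H →ₗ[ℂ] Ind E ρ :=
  ((preTmul ρ).compr₂ (toInd E ρ).toLinearMap).compl₂ η.toLinearMap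

lemma indMapBilin_apply (η : H →L[ℂ] K) (x : E) (h : H) :
    indMapBilin ρ η x h = tmul ρ x (η h) := rfl

variable (E) in
/-- The operator `I_E ⊗ η : E ⊗_σ H → E ⊗_ρ K` for an operator `η : H → K` that intertwines
`σ` and `ρ`; it is determined by `x ⊗ h ↦ x ⊗ η h`. -/
def indMap (η : H →L[ℂ] K) (hη : ∀ b, η ∘L σ b = ρ b ∘L η) : Ind E σ →L[ℂ] Ind E ρ :=
  indLift σ (indMapBilin ρ η) ‖η‖ fun u => by
    obtain ⟨n, x, h, rfl⟩ := pre_exists_sum u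
    obtain ⟨R, hR⟩ := exists_gram_factor (B := B) x
    have e1 : preLift σ (indMapBilin ρ η) (∑ i, preTmul σ (x i) (h i)) =
        toInd E ρ (∑ i, preTmul ρ (x i) (η (h i))) := by
      rw [map_sum, map_sum]
      exact Finset.sum_congr rfl fun i _ => rfl
    refine le_mul_of_sq (norm_nonneg _) (norm_nonneg _) ?_
    rw [e1, LinearIsometry.norm_map, pre_norm_sq, pre_norm_sq, preForm_sum_eq ρ hR,
      preForm_sum_eq σ hR, Complex.ofReal_re, Complex.ofReal_re, Finset.mul_sum]
    refine Finset.sum_le_sum fun k _ => ?_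
    have e2 : ∑ j, ρ (R k j) (η (h j)) = η (∑ j, σ (R k j) (h j)) := by
      rw [map_sum]
      exact Finset.sum_congr rfl fun j _ => (DFunLike.congr_fun (hη (R k j)) (h j)).symm
    rw [e2, ← mul_pow]
    gcongr
    exact η.le_opNorm _

@[simp]
lemma indMap_tmul (η : H →L[ℂ] K) (hη : ∀ b, η ∘L σ b = ρ b ∘L η) (x : E) (h : H) :
    indMap E η hη (tmul σ x h) = tmul ρ x (η h) := by
  rw [indMap, indLift_tmul, indMapBilin_apply]

end IndMap

/-! #### Isometries out of `E ⊗_σ H` -/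

/-- A bilinear map on `E × H` with the right inner products gives an isometry on `E ⊗_σ H`. -/
def indIsom {M : Type*} [NormedAddCommGroup M] [InnerProductSpace ℂ M] [CompleteSpace M]
    (f : E →ₗ[ℂ] H →ₗ[ℂ] M)
    (hf : ∀ x h y k, inner ℂ (f x h) (f y k) = inner ℂ h (σ (ip x y) k)) : Ind E σ →L[ℂ] M :=
  indLift σ f 1 fun u => by
    have key : ∀ u v, inner ℂ (preLift σ f u) (preLift σ f v) = preForm σ u v := by
      intro u v
      induction u using pre_induction with
      | h0 => simp
      | ha u u' hu hu' => rw [map_add, inner_add_left, map_add, LinearMap.add_apply, hu, hu']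
      | ht x h =>
        induction v using pre_induction with
        | h0 => simp
        | ha v v' hv hv' => rw [map_add, inner_add_right, map_add, hv, hv']
        | ht y k => exact hf x h y k
    refine le_mul_of_sq (norm_nonneg _) zero_le_one ?_
    rw [pre_norm_sq, norm_sq_eq_re_inner (𝕜 := ℂ), key, one_pow, one_mul]
    rfl

@[simp]
lemma indIsom_tmul {M : Type*} [NormedAddCommGroup M] [InnerProductSpace ℂ M] [CompleteSpace M]
    (f : E →ₗ[ℂ] H →ₗ[ℂ] M)
    (hf : ∀ x h y k, inner ℂ (f x h) (f y k) = inner ℂ h (σ (ip x y) k)) (x : E) (h : H) :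
    indIsom σ f hf (tmul σ x h) = f x h := indLift_tmul σ f 1 _ x h

end Ind

/-! ### The induced representation -/

section IndRep

variable {A B E H : Type*} [CStarAlgebra A] [PartialOrder A] [StarOrderedRing A]
  [CStarAlgebra B] [PartialOrder B] [StarOrderedRing B]
  [NormedAddCommGroup E] [NormedSpace ℂ E] [Module A E] [Module Bᵐᵒᵖ E]
  [RightHilbertModule B E] [WStarCorrespondence A B E]
  [NormedAddCommGroup H] [InnerProductSpace ℂ H] [CompleteSpace H]

lemma act_smul_complex {A : Type*} (B : Type*) {E : Type*} [CStarAlgebra A] [PartialOrder A]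
    [CStarAlgebra B] [PartialOrder B] [NormedAddCommGroup E] [NormedSpace ℂ E]
    [Module A E] [Module Bᵐᵒᵖ E] [RightHilbertModule B E] [WStarCorrespondence A B E]
    (a : A) (c : ℂ) (x : E) : a • (c • x) = c • (a • x) := by
  have hadj : ∀ (z y : E), (ip z (a • y) : B) = ip (star a • z) y := fun z y => by
    rw [WStarCorrespondence.ip_act_left, star_star]
  refine ext_ip B fun z => ?_
  rw [hadj, ip_smul_right, ip_smul_right, hadj]

/-- The operator `x ↦ a x` of the left action. -/
def actLin {A : Type*} (B E : Type*) [CStarAlgebra A] [PartialOrder A]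
    [CStarAlgebra B] [PartialOrder B] [NormedAddCommGroup E] [NormedSpace ℂ E]
    [Module A E] [Module Bᵐᵒᵖ E] [RightHilbertModule B E] [WStarCorrespondence A B E]
    (a : A) : E →ₗ[ℂ] E where
  toFun x := a • x
  map_add' x y := smul_add a x y
  map_smul' c x := act_smul_complex B a c x

variable (σ : B →⋆ₙₐ[ℂ] (H →L[ℂ] H))

/-- `x ⊗ h ↦ a x ⊗ h` on the algebraic tensor product. -/
def preAct (a : A) : IndPre E σ →ₗ[ℂ] IndPre E σ :=
  preLift σ ((preTmul σ).comp (actLin B E a))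

@[simp]
lemma preAct_tmul (a : A) (x : E) (h : H) :
    preAct σ a (preTmul σ x h) = preTmul σ (a • x) h := rfl

lemma preForm_preAct (a : A) (u v : IndPre E σ) :
    preForm σ (preAct σ a u) v = preForm σ u (preAct σ (star a) v) := by
  induction u using pre_induction with
  | h0 => simp
  | ha u u' hu hu' => simp [hu, hu']
  | ht x h =>
    induction v using pre_induction with
    | h0 => simp
    | ha v v' hv hv' => rw [map_add, map_add, map_add, hv, hv']
    | ht y k =>
      rw [preAct_tmul, preAct_tmul, preForm_tmul, preForm_tmul, WStarCorrespondence.ip_act_left]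

lemma preAct_mul (a b : A) (u : IndPre E σ) :
    preAct σ (a * b) u = preAct σ a (preAct σ b u) := by
  induction u using pre_induction with
  | h0 => simp
  | ha u u' hu hu' => simp [hu, hu']
  | ht x h => simp [mul_smul]

lemma preAct_sub (a b : A) (u : IndPre E σ) :
    preAct σ (a - b) u = preAct σ a u - preAct σ b u := by
  induction u using pre_induction with
  | h0 => simp
  | ha u u' hu hu' => simp [hu, hu']; abel
  | ht x h => simp [sub_smul]

lemma preAct_algebraMap (c : ℂ) (u : IndPre E σ) :
    preAct σ (algebraMap ℂ A c) u = c • u := by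
  induction u using pre_induction with
  | h0 => simp
  | ha u u' hu hu' => simp [hu, hu']
  | ht x h =>
    rw [preAct_tmul, Algebra.algebraMap_eq_smul_one, WStarCorrespondence.smul_smul_complex (B := B),
      one_smul, map_smul, LinearMap.smul_apply]

lemma norm_preAct_le (a : A) (u : IndPre E σ) : ‖preAct σ a u‖ ≤ ‖a‖ * ‖u‖ := by
  refine le_mul_of_sq (norm_nonneg _) (norm_nonneg _) ?_
  have h1 : star a * a ≤ algebraMap ℝ A (‖a‖ ^ 2) := CStarAlgebra.star_mul_le_algebraMap_norm_sq
  obtain ⟨c, hc⟩ := CStarAlgebra.nonneg_iff_eq_star_mul_self.mp (sub_nonneg.mpr h1)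
  have h2 := preForm_self_nonneg σ (preAct σ c u)
  rw [preForm_preAct, ← preAct_mul, ← hc, preAct_sub, preAct_mul, map_sub, ← preForm_preAct,
    IsScalarTower.algebraMap_apply ℝ ℂ A, preAct_algebraMap, map_smul, Complex.sub_re,
    ← pre_norm_sq] at h2
  rw [pre_norm_sq σ u]
  have h3 : (algebraMap ℝ ℂ (‖a‖ ^ 2) • preForm σ u u).re = ‖a‖ ^ 2 * (preForm σ u u).re := by
    rw [Complex.coe_algebraMap, smul_eq_mul, Complex.re_ofReal_mul]
  rw [h3] at h2
  exact sub_nonneg.mp h2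

/-- `x, h ↦ a x ⊗ h`. -/
def actBilin (a : A) : E →ₗ[ℂ] H →ₗ[ℂ] Ind E σ :=
  (indMapBilin σ (ContinuousLinearMap.id ℂ H)).comp (actLin B E a)

lemma actBilin_apply (a : A) (x : E) (h : H) : actBilin σ a x h = tmul σ (a • x) h := rfl

/-- The operator `a ⊗ I` on `E ⊗_σ H`. -/
def indAct (a : A) : Ind E σ →L[ℂ] Ind E σ :=
  indLift σ (actBilin σ a) ‖a‖ fun u => by
    have : preLift σ (actBilin σ a) u = toInd E σ (preAct σ a u) := by
      induction u using pre_induction with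
      | h0 => simp only [map_zero]
      | ha u u' hu hu' => simp only [map_add, hu, hu']
      | ht x h => rfl
    rw [this, LinearIsometry.norm_map]
    exact norm_preAct_le σ a u

@[simp]
lemma indAct_tmul (a : A) (x : E) (h : H) : indAct σ a (tmul σ x h) = tmul σ (a • x) h := by
  rw [indAct, indLift_tmul, actBilin_apply]

lemma tmul_add_left (x y : E) (h : H) : tmul σ (x + y) h = tmul σ x h + tmul σ y h := by
  simp [tmul]

lemma tmul_smul_left (c : ℂ) (x : E) (h : H) : tmul σ (c • x) h = c • tmul σ x h := by
  simp [tmul]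

variable (A E) in
/-- The induced representation `σ^E ∘ φ` of `A` on `E ⊗_σ H`, `a ↦ a ⊗ I`, i.e.
`a ⊗ I : x ⊗ h ↦ a x ⊗ h`. -/
def indRep : A →⋆ₙₐ[ℂ] (Ind E σ →L[ℂ] Ind E σ) where
  toFun := indAct σ
  map_smul' c a := ind_ext σ fun x h => by
    simp [WStarCorrespondence.smul_smul_complex (B := B), tmul_smul_left]
  map_zero' := ind_ext σ fun x h => by
    rw [indAct_tmul, zero_smul, tmul, map_zero, LinearMap.zero_apply,
      map_zero, zero_apply]
  map_add' a b := ind_ext σ fun x h => by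
    simp [add_smul, tmul_add_left]
  map_mul' a b := ind_ext σ fun x h => by
    simp [mul_smul]
  map_star' a := by
    refine (ContinuousLinearMap.eq_adjoint_iff _ _).mpr fun u v => ?_
    induction u, v using ind_induction₂ with
    | hp =>
      exact isClosed_eq (((indAct σ (star a)).continuous.comp continuous_fst).inner continuous_snd)
        (continuous_fst.inner ((indAct σ a).continuous.comp continuous_snd))
    | ih u v =>
      induction u using pre_induction with
      | h0 => simp only [map_zero, inner_zero_left]
      | ha u u' hu hu' => simp only [map_add, inner_add_left, hu, hu']
      | ht x h =>
        induction v using pre_induction with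
        | h0 => simp only [map_zero, inner_zero_right]
        | ha v v' hv hv' =>
          simp only [map_add, inner_add_right, hv, hv']
        | ht y k =>
          change inner ℂ (indAct σ (star a) (tmul σ x h)) (tmul σ y k) =
            inner ℂ (tmul σ x h) (indAct σ a (tmul σ y k))
          rw [indAct_tmul, indAct_tmul, inner_tmul_tmul, inner_tmul_tmul,
            WStarCorrespondence.ip_act_left, star_star]

@[simp]
lemma indRep_tmul (a : A) (x : E) (h : H) :
    indRep A E σ a (tmul σ x h) = tmul σ (a • x) h := indAct_tmul σ a x h

end IndRep

/-! ### The intertwining space and its disc -/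

/-- The intertwining space `(E^σ)^*`, for a W⋆-correspondence `(E, A)` and a representation `σ`
of `A`: the operators `η^* : E ⊗_σ H → H` with `η^* (a ⊗ I) = σ(a) η^*` for all `a`. -/
def intertwiners {A : Type*} (E : Type*) {H : Type*} [CStarAlgebra A] [PartialOrder A]
    [StarOrderedRing A] [NormedAddCommGroup E] [NormedSpace ℂ E] [Module A E]
    [Module Aᵐᵒᵖ E] [RightHilbertModule A E] [WStarCorrespondence A A E]
    [NormedAddCommGroup H] [InnerProductSpace ℂ H] [CompleteSpace H]
    (σ : A →⋆ₙₐ[ℂ] (H →L[ℂ] H)) : Submodule ℂ (Ind E σ →L[ℂ] H) where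
  carrier := {η | ∀ a, η ∘L indRep A E σ a = σ a ∘L η}
  zero_mem' a := by simp
  add_mem' hη hζ a := by
    rw [ContinuousLinearMap.add_comp, ContinuousLinearMap.comp_add, hη a, hζ a]
  smul_mem' c η hη a := by
    rw [ContinuousLinearMap.smul_comp, ContinuousLinearMap.comp_smul, hη a]

section Disc

variable (V : Type*) [NormedAddCommGroup V] [NormedSpace ℂ V]

/-- The open unit disc of a normed space. -/
abbrev Disc : Set V := Metric.ball (0 : V) 1

variable {V} in
/-- A self-map of the open unit disc is holomorphic if it is complex (Fréchet) differentiable at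
every point of the disc. -/
def IsHolomorphic (g : Disc V → Disc V) : Prop :=
  ∃ G : V → V, DifferentiableOn ℂ G (Disc V) ∧ ∀ p : Disc V, G p = g p

/-- The group of biholomorphic automorphisms of the open unit disc. -/
def discAut : Subgroup (Equiv.Perm (Disc V)) where
  carrier := {g | IsHolomorphic g ∧ IsHolomorphic g.symm}
  one_mem' := by
    have : IsHolomorphic (fun p : Disc V => p) := ⟨id, differentiableOn_id, fun _ => rfl⟩
    exact ⟨this, this⟩
  mul_mem' := by
    have comp : ∀ f g : Disc V → Disc V, IsHolomorphic f → IsHolomorphic g →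
        IsHolomorphic (f ∘ g) := by
      rintro f g ⟨F, hF, hFf⟩ ⟨G, hG, hGg⟩
      refine ⟨F ∘ G, hF.comp hG fun v hv => ?_, fun p => ?_⟩
      · have := hGg ⟨v, hv⟩
        simp only at this
        rw [this]
        exact (g ⟨v, hv⟩).2
      · rw [Function.comp_apply, hGg, hFf, Function.comp_apply]
    rintro f g ⟨hf, hf'⟩ ⟨hg, hg'⟩
    exact ⟨comp f g hf hg, comp g.symm f.symm hg' hf'⟩
  inv_mem' := fun h => ⟨h.2, h.1⟩

/-- The category whose objects are the points of the open unit disc of `V` and whose morphisms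
are the biholomorphic automorphisms of the disc carrying one point to another. -/
structure DiscCat where
  /-- the point of the disc -/
  pt : Disc V

/-- Morphisms `p ⟶ q`: the automorphisms `g` of the disc with `g p = q`. -/
@[ext]
structure DiscCat.Hom {V : Type*} [NormedAddCommGroup V] [NormedSpace ℂ V] (p q : DiscCat V) where
  /-- the automorphism of the disc -/
  aut : discAut V
  map_pt : aut.1 p.pt = q.pt

instance : Category (DiscCat V) where
  Hom p q := DiscCat.Hom p q
  id p := ⟨1, rfl⟩
  comp f g := ⟨g.aut * f.aut, by
    rw [← g.map_pt, ← f.map_pt]; rfl⟩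
  id_comp f := DiscCat.Hom.ext (mul_one _)
  comp_id f := DiscCat.Hom.ext (one_mul _)
  assoc f g h := DiscCat.Hom.ext (mul_assoc _ _ _).symm

end Disc

section Covrep

variable {A : Type*} (E : Type*) {H : Type*} [CStarAlgebra A] [PartialOrder A]
  [StarOrderedRing A] [NormedAddCommGroup E] [NormedSpace ℂ E] [Module A E]
  [Module Aᵐᵒᵖ E] [RightHilbertModule A E] [WStarCorrespondence A A E]
  [NormedAddCommGroup H] [InnerProductSpace ℂ H] [CompleteSpace H]
  (σ : A →⋆ₙₐ[ℂ] (H →L[ℂ] H))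

/-- The category `σ-Covrep E`: its objects are the points of the open unit disc of `(E^σ)^*`
(for the operator norm), its morphisms the automorphisms of that disc carrying one point to
another. -/
abbrev Covrep : Type _ := DiscCat (intertwiners E σ)

end Covrep

/-! ### The transform `η^* ↦ (I_X ⊗ η^*)(W ⊗ I_H)` -/

section Transform

variable {C A B E X Z H : Type*}
  [CStarAlgebra C] [PartialOrder C] [StarOrderedRing C]
  [CStarAlgebra A] [PartialOrder A] [StarOrderedRing A]
  [CStarAlgebra B] [PartialOrder B] [StarOrderedRing B]
  [NormedAddCommGroup E] [NormedSpace ℂ E] [Module C E] [Module Aᵐᵒᵖ E]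
  [RightHilbertModule A E] [WStarCorrespondence C A E]
  [NormedAddCommGroup X] [NormedSpace ℂ X] [Module A X] [Module Bᵐᵒᵖ X]
  [RightHilbertModule B X] [WStarCorrespondence A B X]
  [NormedAddCommGroup Z] [NormedSpace ℂ Z] [Module C Z] [Module Bᵐᵒᵖ Z]
  [RightHilbertModule B Z] [WStarCorrespondence C B Z]
  [NormedAddCommGroup H] [InnerProductSpace ℂ H] [CompleteSpace H]

/-- `x, h ↦ t e x ⊗ h`. -/
def assocBilin (t : E →ₗ[ℂ] X →ₗ[ℂ] Z) (σ : B →⋆ₙₐ[ℂ] (H →L[ℂ] H)) (e : E) :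
    X →ₗ[ℂ] H →ₗ[ℂ] Ind Z σ :=
  (indMapBilin σ (ContinuousLinearMap.id ℂ H)).comp (t e)

lemma assocBilin_apply (t : E →ₗ[ℂ] X →ₗ[ℂ] Z) (σ : B →⋆ₙₐ[ℂ] (H →L[ℂ] H)) (e : E)
    (x : X) (h : H) : assocBilin t σ e x h = tmul σ (t e x) h := rfl

lemma inner_assocBilin {t : E →ₗ[ℂ] X →ₗ[ℂ] Z} (ht : IsWStarTensor C A B t)
    (σ : B →⋆ₙₐ[ℂ] (H →L[ℂ] H)) (e e' : E) (u v : IndPre X σ) :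
    inner ℂ (preLift σ (assocBilin t σ e) u) (preLift σ (assocBilin t σ e') v) =
      inner ℂ (toInd X σ u) (indRep A X σ (ip e e') (toInd X σ v)) := by
  induction u using pre_induction with
  | h0 => simp only [map_zero, inner_zero_left]
  | ha u u' hu hu' =>
    simp only [map_add, inner_add_left, hu, hu']
  | ht x h =>
    induction v using pre_induction with
    | h0 =>
      simp only [map_zero, inner_zero_right]
    | ha v v' hv hv' =>
      simp only [map_add, inner_add_right, hv, hv']
    | ht y k =>
      rw [preLift_tmul, preLift_tmul, assocBilin_apply, assocBilin_apply, inner_tmul_tmul,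
        ht.ip_tmul]
      change _ = inner ℂ (tmul σ x h) (indRep A X σ (ip e e') (tmul σ y k))
      rw [indRep_tmul, inner_tmul_tmul]

/-- The operator `X ⊗_σ H → Z ⊗_σ H`, `x ⊗ h ↦ (e ⊗ x) ⊗ h`. -/
def assocOp {t : E →ₗ[ℂ] X →ₗ[ℂ] Z} (ht : IsWStarTensor C A B t)
    (σ : B →⋆ₙₐ[ℂ] (H →L[ℂ] H)) (e : E) : Ind X σ →L[ℂ] Ind Z σ :=
  indLift σ (assocBilin t σ e) √‖indRep A X σ (ip e e)‖ fun u => by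
    refine le_mul_of_sq (norm_nonneg _) (Real.sqrt_nonneg _) ?_
    rw [Real.sq_sqrt (norm_nonneg _), norm_sq_eq_re_inner (𝕜 := ℂ), inner_assocBilin ht]
    refine (Complex.re_le_norm _).trans ((norm_inner_le_norm _ _).trans ?_)
    have := (indRep A X σ (ip e e)).le_opNorm (toInd X σ u)
    rw [LinearIsometry.norm_map] at this ⊢
    nlinarith [norm_nonneg u]

@[simp]
lemma assocOp_tmul {t : E →ₗ[ℂ] X →ₗ[ℂ] Z} (ht : IsWStarTensor C A B t)
    (σ : B →⋆ₙₐ[ℂ] (H →L[ℂ] H)) (e : E) (x : X) (h : H) :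
    assocOp ht σ e (tmul σ x h) = tmul σ (t e x) h := by
  rw [assocOp, indLift_tmul, assocBilin_apply]

lemma inner_assocOp {t : E →ₗ[ℂ] X →ₗ[ℂ] Z} (ht : IsWStarTensor C A B t)
    (σ : B →⋆ₙₐ[ℂ] (H →L[ℂ] H)) (e e' : E) (ξ ζ : Ind X σ) :
    inner ℂ (assocOp ht σ e ξ) (assocOp ht σ e' ζ) = inner ℂ ξ (indRep A X σ (ip e e') ζ) := by
  induction ξ, ζ using ind_induction₂ with
  | hp =>
    exact isClosed_eq (((assocOp ht σ e).continuous.comp continuous_fst).inner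
        ((assocOp ht σ e').continuous.comp continuous_snd))
      (continuous_fst.inner ((indRep A X σ (ip e e')).continuous.comp continuous_snd))
  | ih u v =>
    rw [← inner_assocBilin ht, assocOp, assocOp, indLift_toInd, indLift_toInd]

/-- `e, ξ ↦ (x ⊗ h ↦ (e ⊗ x) ⊗ h) ξ`. -/
def assocOpBilin {t : E →ₗ[ℂ] X →ₗ[ℂ] Z} (ht : IsWStarTensor C A B t)
    (σ : B →⋆ₙₐ[ℂ] (H →L[ℂ] H)) : E →ₗ[ℂ] Ind X σ →ₗ[ℂ] Ind Z σ :=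
  LinearMap.mk₂ ℂ (fun e ξ => assocOp ht σ e ξ)
    (fun e e' ξ => DFunLike.congr_fun (ind_ext σ (S := assocOp ht σ (e + e'))
      (T := assocOp ht σ e + assocOp ht σ e') fun x h => by simp [tmul_add_left]) ξ)
    (fun c e ξ => DFunLike.congr_fun (ind_ext σ (S := assocOp ht σ (c • e))
      (T := c • assocOp ht σ e) fun x h => by simp [tmul_smul_left]) ξ)
    (fun e ξ ζ => map_add _ ξ ζ)
    (fun c e ξ => map_smul _ c ξ)

lemma assocOpBilin_apply {t : E →ₗ[ℂ] X →ₗ[ℂ] Z} (ht : IsWStarTensor C A B t)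
    (σ : B →⋆ₙₐ[ℂ] (H →L[ℂ] H)) (e : E) (ξ : Ind X σ) :
    assocOpBilin ht σ e ξ = assocOp ht σ e ξ := rfl

/-- The canonical isometry `E ⊗ (X ⊗_σ H) → (E ⊗ X) ⊗_σ H`, `e ⊗ (x ⊗ h) ↦ (e ⊗ x) ⊗ h`,
where `E ⊗ X = Z` is the W⋆-tensor product. It is a unitary when `σ` is normal. -/
def assocIsom {t : E →ₗ[ℂ] X →ₗ[ℂ] Z} (ht : IsWStarTensor C A B t)
    (σ : B →⋆ₙₐ[ℂ] (H →L[ℂ] H)) : Ind E (indRep A X σ) →L[ℂ] Ind Z σ :=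
  indIsom (indRep A X σ) (assocOpBilin ht σ) fun e ξ e' ζ => by
    rw [assocOpBilin_apply, assocOpBilin_apply, inner_assocOp ht σ e e' ξ ζ]

lemma assocIsom_tmul {t : E →ₗ[ℂ] X →ₗ[ℂ] Z} (ht : IsWStarTensor C A B t)
    (σ : B →⋆ₙₐ[ℂ] (H →L[ℂ] H)) (e : E) (x : X) (h : H) :
    assocIsom ht σ (tmul (indRep A X σ) e (tmul σ x h)) = tmul σ (t e x) h := by
  exact (indIsom_tmul (indRep A X σ) (assocOpBilin ht σ) _ e (tmul σ x h)).trans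
    (assocOp_tmul ht σ e x h)

/-- The operator `W ⊗ I_H : Z₁ ⊗_σ H → Z₂ ⊗_σ H`, `z ⊗ h ↦ W z ⊗ h`. -/
def isoTensorId {Z₁ Z₂ : Type*}
    [NormedAddCommGroup Z₁] [NormedSpace ℂ Z₁] [Module A Z₁] [Module Bᵐᵒᵖ Z₁]
    [RightHilbertModule B Z₁]
    [NormedAddCommGroup Z₂] [NormedSpace ℂ Z₂] [Module A Z₂] [Module Bᵐᵒᵖ Z₂]
    [RightHilbertModule B Z₂]
    (W : CorrespondenceIso A B Z₁ Z₂) (σ : B →⋆ₙₐ[ℂ] (H →L[ℂ] H)) : Ind Z₁ σ →L[ℂ] Ind Z₂ σ :=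
  indIsom σ ((indMapBilin σ (ContinuousLinearMap.id ℂ H)).comp W.toLinearEquiv.toLinearMap)
    fun z h z' k => by
      have hW : ∀ (z : Z₁) (h : H), ((indMapBilin σ (ContinuousLinearMap.id ℂ H)).comp
          W.toLinearEquiv.toLinearMap) z h = tmul σ (W.toFun z) h := fun _ _ => rfl
      rw [hW, hW, inner_tmul_tmul, W.map_ip]

end Transform

section Main

variable {A B E F X Z₁ Z₂ H : Type*}
  [CStarAlgebra A] [PartialOrder A] [StarOrderedRing A]
  [CStarAlgebra B] [PartialOrder B] [StarOrderedRing B]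
  [NormedAddCommGroup E] [NormedSpace ℂ E] [Module A E] [Module Aᵐᵒᵖ E]
  [RightHilbertModule A E] [WStarCorrespondence A A E]
  [NormedAddCommGroup F] [NormedSpace ℂ F] [Module B F] [Module Bᵐᵒᵖ F]
  [RightHilbertModule B F] [WStarCorrespondence B B F]
  [NormedAddCommGroup X] [NormedSpace ℂ X] [Module A X] [Module Bᵐᵒᵖ X]
  [RightHilbertModule B X] [WStarCorrespondence A B X]
  [NormedAddCommGroup Z₁] [NormedSpace ℂ Z₁] [Module A Z₁] [Module Bᵐᵒᵖ Z₁]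
  [RightHilbertModule B Z₁] [WStarCorrespondence A B Z₁]
  [NormedAddCommGroup Z₂] [NormedSpace ℂ Z₂] [Module A Z₂] [Module Bᵐᵒᵖ Z₂]
  [RightHilbertModule B Z₂] [WStarCorrespondence A B Z₂]
  [NormedAddCommGroup H] [InnerProductSpace ℂ H] [CompleteSpace H]

/-- The operator `(I_X ⊗ η^*)(W ⊗ I_H) : E ⊗ (X ⊗_σ H) → X ⊗_σ H`, where `W` is an isomorphism
from the W⋆-tensor product `Z₁` of `E` and `X` onto the W⋆-tensor product `Z₂` of `X` and `F`.
It is the composite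
`E ⊗ (X ⊗_σ H) → Z₁ ⊗_σ H → Z₂ ⊗_σ H → X ⊗ (F ⊗_σ H) → X ⊗_σ H`
of the canonical unitary, of `W ⊗ I_H`, of the inverse (that is, the adjoint) of the canonical
unitary, and of `I_X ⊗ η^*`. -/
def transform {t₁ : E →ₗ[ℂ] X →ₗ[ℂ] Z₁} (ht₁ : IsWStarTensor A A B t₁)
    {t₂ : X →ₗ[ℂ] F →ₗ[ℂ] Z₂} (ht₂ : IsWStarTensor A B B t₂)
    (W : CorrespondenceIso A B Z₁ Z₂) (σ : B →⋆ₙₐ[ℂ] (H →L[ℂ] H)) (η : intertwiners F σ) :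
    Ind E (indRep A X σ) →L[ℂ] Ind X σ :=
  indMap X η.1 η.2 ∘L ContinuousLinearMap.adjoint (assocIsom ht₂ σ) ∘L isoTensorId W σ ∘L
    assocIsom ht₁ σ

end Main

end WStarMorita

end

open scoped TensorProduct RightActions

noncomputable section

set_option linter.unusedSectionVars false

namespace WStarMorita

open CategoryTheory Filter Topology
open RightHilbertModule (ip)

/-! ### Normal representations -/

section Normal

variable {H : Type*} [NormedAddCommGroup H] [InnerProductSpace ℂ H] [CompleteSpace H]

/-! The transform has the form `η ↦ (I_X ⊗ η) U`, where `U : E ⊗ (X ⊗_σ H) → X ⊗ (F ⊗_σ H)` is built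
from `W` and the two associativity maps and does not depend on `η`. The theorem follows once this is
a surjective linear isometry between the two intertwining spaces: such a map carries one open unit
ball onto the other, and conjugation by it carries biholomorphic automorphisms to biholomorphic
automorphisms, compatibly with the points.

Two facts carry the argument. The first is that `U` is a unitary intertwining the actions of `A`
(`isUnitaryIntertwiner_transport`). The associativity maps are isometries for formal reasons; the
difficulty is surjectivity, because elementary tensors are only weak-⋆ dense in a W⋆-tensor product.
Normality of `σ` bridges the gap: `tmul_congr` shows that an element of `Z` acts on `H` only through
its inner products with elementary tensors. Fullness of `X` and self-duality then put a total set of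
vectors in the range (`tmul_total_of_left`, `tmul_total_of_right`).

The second is the commutant statement `exists_eq_indMap`: every operator commuting with the actions
of `A` on `X ⊗_ρ K` and `X ⊗_σ H` is `I_X ⊗ η` for an intertwiner `η`. It uses that the elements
`ₐ⟨x, y⟩` of `A` act as rank one operators, together with `‖I_X ⊗ η‖ = ‖η‖` in the form of the a
priori bound `norm_le_of_tmul_eq`. That bound comes from contractions `∑ ⟨wᵢ, wᵢ⟩` tending strongly
to `σ(1)`, which exist because the `B`-valued inner product is weak-⋆ full.

Representations are not assumed unital, so `σ(1)` appears where one would expect the identity.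
Induced representations are unital. -/

/-- A weak limit of positive operators is positive. -/
lemma isPositive_of_tendsto {ι : Type*} {l : Filter ι} [l.NeBot] {p : ι → H →L[ℂ] H}
    {P : H →L[ℂ] H} (hp : ∀ᶠ i in l, (p i).IsPositive)
    (hP : ∀ v, Tendsto (fun i => inner ℂ (p i v) v) l (𝓝 (inner ℂ (P v) v))) : P.IsPositive := by
  rw [ContinuousLinearMap.isPositive_iff_complex]
  intro v
  have hre : Tendsto (fun i => (inner ℂ (p i v) v).re) l (𝓝 (inner ℂ (P v) v).re) :=
    (Complex.continuous_re.tendsto _).comp (hP v)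
  constructor
  · refine tendsto_nhds_unique ?_ (hP v)
    refine ((Complex.continuous_ofReal.tendsto _).comp hre).congr' ?_
    filter_upwards [hp] with i hi
    exact (((p i).isPositive_iff_complex.mp hi) v).1
  · refine ge_of_tendsto hre ?_
    filter_upwards [hp] with i hi
    exact (((p i).isPositive_iff_complex.mp hi) v).2

/-- The supremum of a directed set of operators is its weak limit. -/
lemma exists_re_inner_sub_lt {S : Set (H →L[ℂ] H)} (hne : S.Nonempty)
    (hdir : DirectedOn (· ≤ ·) S) {T : H →L[ℂ] H} (hT : IsLUB S T) (h : H) {ε : ℝ} (hε : 0 < ε) :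
    ∃ s ∈ S, (inner ℂ ((T - s) h) h).re < ε := by
  have : Nonempty S := hne.to_subtype
  have : IsDirectedOrder S := ⟨fun a b => by
    obtain ⟨c, hc, hac, hbc⟩ := hdir a a.2 b b.2
    exact ⟨⟨c, hc⟩, hac, hbc⟩⟩
  let p : S → H →L[ℂ] H := fun s => T - s
  have hpos : ∀ s, (p s).IsPositive := fun s => (ContinuousLinearMap.le_def _ _).mp (hT.1 s.2)
  have hanti : ∀ s t : S, s ≤ t → (p s - p t).IsPositive := fun s t hst => by
    have : p s - p t = t.1 - s.1 := by simp [p]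
    rw [this]
    exact (ContinuousLinearMap.le_def _ _).mp hst
  have hcoe : ∀ s v, ((inner ℂ (p s v) v).re : ℂ) = inner ℂ (p s v) v := fun s v =>
    (((p s).isPositive_iff_complex.mp (hpos s)) v).1
  -- The quadratic forms of `T - s` decrease along the directed set and are bounded below by zero.
  have hquad : ∀ v, ∃ l, Tendsto (fun s => inner ℂ (p s v) v) atTop (𝓝 l) := fun v => by
    have h1 : Antitone fun s => (inner ℂ (p s v) v).re := fun s t hst => by
      have := (((p s - p t).isPositive_iff_complex.mp (hanti s t hst)) v).2
      simpa [inner_sub_left] using this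
    have h2 : BddBelow (Set.range fun s => (inner ℂ (p s v) v).re) := by
      refine ⟨0, ?_⟩
      rintro _ ⟨s, rfl⟩
      exact (((p s).isPositive_iff_complex.mp (hpos s)) v).2
    refine ⟨_, ((Complex.continuous_ofReal.tendsto _).comp (tendsto_atTop_ciInf h1 h2)).congr ?_⟩
    exact fun s => hcoe s v
  -- Polarization upgrades convergence of the quadratic forms to weak convergence.
  have hsesq : ∀ v w, ∃ l, Tendsto (fun s => inner ℂ (p s v) w) atTop (𝓝 l) := fun v w => by
    obtain ⟨l₁, h₁⟩ := hquad (v + w)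
    obtain ⟨l₂, h₂⟩ := hquad (v - w)
    obtain ⟨l₃, h₃⟩ := hquad (v + Complex.I • w)
    obtain ⟨l₄, h₄⟩ := hquad (v - Complex.I • w)
    refine ⟨_, ((((h₁.sub h₂).sub (h₃.const_mul Complex.I)).add
      (h₄.const_mul Complex.I)).div_const 4).congr fun s => ?_⟩
    exact (inner_map_polarization' (p s).toLinearMap v w).symm
  choose L hL using hsesq
  obtain ⟨s₀⟩ := ‹Nonempty S›
  -- Beyond a fixed `s₀` one has `0 ≤ p s ≤ p s₀`, which bounds the norms uniformly and makes the
  -- limit form bounded.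
  have hbound : ∀ v w, ‖L v w‖ ≤ ‖p s₀‖ * ‖v‖ * ‖w‖ := fun v w => by
    refine le_of_tendsto (hL v w).norm ?_
    filter_upwards [eventually_ge_atTop s₀] with s hs
    have h1 : ‖p s‖ ≤ ‖p s₀‖ := CStarAlgebra.norm_le_norm_of_nonneg_of_le
      ((ContinuousLinearMap.nonneg_iff_isPositive _).mpr (hpos s))
      ((ContinuousLinearMap.le_def _ _).mpr (hanti s₀ s hs))
    calc ‖inner ℂ (p s v) w‖ ≤ ‖p s v‖ * ‖w‖ := norm_inner_le_norm _ _
      _ ≤ ‖p s‖ * ‖v‖ * ‖w‖ := by gcongr; exact (p s).le_opNorm v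
      _ ≤ _ := by gcongr
  let Q : H →ₗ⋆[ℂ] H →ₗ[ℂ] ℂ := LinearMap.mk₂'ₛₗ (starRingEnd ℂ) (RingHom.id ℂ) L
    (fun v v' w => tendsto_nhds_unique (hL _ _)
      (((hL v w).add (hL v' w)).congr fun s => by rw [map_add, inner_add_left]))
    (fun c v w => tendsto_nhds_unique (hL _ _)
      (((hL v w).const_mul (starRingEnd ℂ c)).congr fun s => by
        rw [map_smul, inner_smul_left]))
    (fun v w w' => tendsto_nhds_unique (hL _ _)
      (((hL v w).add (hL v w')).congr fun s => by rw [inner_add_right]))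
    (fun c v w => tendsto_nhds_unique (hL _ _)
      (((hL v w).const_mul c).congr fun s => by rw [inner_smul_right]))
  let P : H →L[ℂ] H := InnerProductSpace.continuousLinearMapOfBilin (Q.mkContinuous₂ _ hbound)
  have hP : ∀ v w, inner ℂ (P v) w = L v w := fun v w =>
    InnerProductSpace.continuousLinearMapOfBilin_apply _ v w
  -- `T - P - s` is the weak limit over `t ≥ s` of the positive operators `p s - p t = t - s`.
  -- Minimality of `T` then gives `P ≤ 0`, so the decreasing forms have a limit that is at most
  -- zero.
  have hub : T - P ∈ upperBounds S := fun s hs => by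
    rw [ContinuousLinearMap.le_def]
    have : T - P - s = p ⟨s, hs⟩ - P := by simp only [p]; abel
    rw [this]
    refine isPositive_of_tendsto (l := atTop) (p := fun t : S => p ⟨s, hs⟩ - p t) ?_ fun v => ?_
    · filter_upwards [eventually_ge_atTop (⟨s, hs⟩ : S)] with t ht using hanti _ t ht
    · simp only [sub_apply, inner_sub_left, hP]
      exact (hL v v).const_sub _
  have hneg := ((ContinuousLinearMap.isPositive_iff_complex _).mp
    ((ContinuousLinearMap.le_def _ _).mp (hT.2 hub)) h).2
  have hle : (L h h).re ≤ 0 := by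
    simpa [inner_sub_left, hP, inner_neg_left] using hneg
  have hlim : Tendsto (fun s => (inner ℂ (p s h) h).re) atTop (𝓝 (L h h).re) :=
    (Complex.continuous_re.tendsto _).comp (hL h h)
  obtain ⟨s, hs⟩ := (hlim.eventually_lt_const (hle.trans_lt hε)).exists
  exact ⟨s, s.2, hs⟩

variable {B : Type*} [CStarAlgebra B] [PartialOrder B] [StarOrderedRing B]

/-- A vector `ξ` is normal for a representation `π` if `b ↦ ⟨ξ, π(b) ξ⟩` preserves the suprema
of increasing nets. -/
def IsNormalVector (π : B →⋆ₙₐ[ℂ] (H →L[ℂ] H)) (ξ : H) : Prop :=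
  ∀ ⦃D : Set B⦄, D.Nonempty → DirectedOn (· ≤ ·) D → ∀ ⦃a : B⦄, IsLUB D a →
    ∀ ε : ℝ, 0 < ε → ∃ d ∈ D, (inner ℂ (π (a - d) ξ) ξ).re < ε

lemma re_inner_rep_nonneg (π : B →⋆ₙₐ[ℂ] (H →L[ℂ] H)) {b : B} (hb : 0 ≤ b) (ξ : H) :
    0 ≤ (inner ℂ (π b ξ) ξ).re := by
  obtain ⟨c, rfl⟩ := CStarAlgebra.nonneg_iff_eq_star_mul_self.mp hb
  rw [map_mul, map_star, mul_apply_eq_comp, ContinuousLinearMap.star_eq_adjoint,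
    ContinuousLinearMap.adjoint_inner_left]
  exact inner_self_nonneg (𝕜 := ℂ)

lemma inner_rep_eq_norm_sq (π : B →⋆ₙₐ[ℂ] (H →L[ℂ] H)) (c : B) (ξ : H) :
    (inner ℂ (π (star c * c) ξ) ξ).re = ‖π c ξ‖ ^ 2 := by
  rw [map_mul, map_star, mul_apply_eq_comp, ContinuousLinearMap.star_eq_adjoint,
    ContinuousLinearMap.adjoint_inner_left]
  exact inner_self_eq_norm_sq (𝕜 := ℂ) _

/-- Scott continuity speaks of suprema in the operator order; `exists_re_inner_sub_lt` turns such a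
supremum into a weak limit. -/
lemma isNormalVector_of_scottContinuous {σ : B →⋆ₙₐ[ℂ] (H →L[ℂ] H)} (hσ : ScottContinuous σ)
    (h : H) : IsNormalVector σ h := fun D hne hdir a ha ε hε => by
  have hdir' : DirectedOn (· ≤ ·) (σ '' D) := by
    rintro _ ⟨x, hx, rfl⟩ _ ⟨y, hy, rfl⟩
    obtain ⟨z, hz, hxz, hyz⟩ := hdir x hx y hy
    exact ⟨σ z, ⟨z, hz, rfl⟩, hσ.monotone hxz, hσ.monotone hyz⟩
  obtain ⟨_, ⟨d, hd, rfl⟩, hlt⟩ :=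
    exists_re_inner_sub_lt (hne.image σ) hdir' (hσ hne hdir ha) h hε
  exact ⟨d, hd, by rwa [map_sub]⟩

/-- This is the parallelogram identity for the positive form of `π b`, with the term at `ξ - ζ`
dropped. -/
lemma re_inner_rep_add_le (π : B →⋆ₙₐ[ℂ] (H →L[ℂ] H)) {b : B} (hb : 0 ≤ b) (ξ ζ : H) :
    (inner ℂ (π b (ξ + ζ)) (ξ + ζ)).re ≤
      2 * (inner ℂ (π b ξ) ξ).re + 2 * (inner ℂ (π b ζ) ζ).re := by
  have := re_inner_rep_nonneg π hb (ξ - ζ)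
  simp only [map_sub, map_add, inner_sub_left, inner_sub_right, inner_add_left, inner_add_right,
    Complex.sub_re, Complex.add_re] at this ⊢
  linarith

lemma IsNormalVector.add {π : B →⋆ₙₐ[ℂ] (H →L[ℂ] H)} {ξ ζ : H} (hξ : IsNormalVector π ξ)
    (hζ : IsNormalVector π ζ) : IsNormalVector π (ξ + ζ) := fun D hne hdir a ha ε hε => by
  obtain ⟨d₁, hd₁, h₁⟩ := hξ hne hdir ha (ε / 4) (by positivity)
  obtain ⟨d₂, hd₂, h₂⟩ := hζ hne hdir ha (ε / 4) (by positivity)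
  obtain ⟨d, hd, hd₁d, hd₂d⟩ := hdir d₁ hd₁ d₂ hd₂
  refine ⟨d, hd, ?_⟩
  have key : ∀ e, e ≤ d → ∀ ξ : H,
      (inner ℂ (π (a - d) ξ) ξ).re ≤ (inner ℂ (π (a - e) ξ) ξ).re := fun e he ξ => by
    have := re_inner_rep_nonneg π (sub_nonneg.mpr he) ξ
    simp only [map_sub, sub_apply, inner_sub_left, Complex.sub_re] at this ⊢
    linarith
  have h3 := re_inner_rep_add_le π (sub_nonneg.mpr (ha.1 hd)) ξ ζ
  linarith [key d₁ hd₁d ξ, key d₂ hd₂d ζ]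

/-- The normal vectors form a closed set. -/
lemma isClosed_isNormalVector (π : B →⋆ₙₐ[ℂ] (H →L[ℂ] H)) :
    IsClosed {ξ | IsNormalVector π ξ} := by
  rw [← isSeqClosed_iff_isClosed]
  intro u ξ hu hlim D hne hdir a ha ε hε
  obtain ⟨d₀, hd₀⟩ := hne
  -- Only elements `d ≥ d₀` are used: there `‖a - d‖ ≤ ‖a - d₀‖`, so the error made by replacing `ξ`
  -- with `u n` is small uniformly in `d`, and `n` can be chosen before `d`.
  have hlim' : Tendsto (fun n => 2 * (‖a - d₀‖ * ‖ξ - u n‖ ^ 2)) atTop (𝓝 0) := by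
    have h1 : Tendsto (fun n => ‖ξ - u n‖) atTop (𝓝 0) := by
      simpa using ((tendsto_const_nhds (x := ξ)).sub hlim).norm
    simpa using ((h1.pow 2).const_mul ‖a - d₀‖).const_mul 2
  obtain ⟨n, hn⟩ := (hlim'.eventually_lt_const (half_pos hε)).exists
  obtain ⟨d₁, hd₁, h₁⟩ := hu n ⟨d₀, hd₀⟩ hdir ha (ε / 4) (by positivity)
  obtain ⟨d, hd, hd₀d, hd₁d⟩ := hdir d₀ hd₀ d₁ hd₁
  refine ⟨d, hd, ?_⟩
  have h2 := re_inner_rep_add_le π (sub_nonneg.mpr (ha.1 hd)) (u n) (ξ - u n)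
  rw [add_sub_cancel] at h2
  have h3 : (inner ℂ (π (a - d) (u n)) (u n)).re ≤ (inner ℂ (π (a - d₁) (u n)) (u n)).re := by
    have := re_inner_rep_nonneg π (sub_nonneg.mpr hd₁d) (u n)
    simp only [map_sub, sub_apply, inner_sub_left, Complex.sub_re] at this ⊢
    linarith
  have h4 : (inner ℂ (π (a - d) (ξ - u n)) (ξ - u n)).re ≤ ‖a - d₀‖ * ‖ξ - u n‖ ^ 2 := by
    calc (inner ℂ (π (a - d) (ξ - u n)) (ξ - u n)).re
        ≤ ‖inner ℂ (π (a - d) (ξ - u n)) (ξ - u n)‖ := Complex.re_le_norm _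
      _ ≤ ‖π (a - d) (ξ - u n)‖ * ‖ξ - u n‖ := norm_inner_le_norm _ _
      _ ≤ ‖π (a - d)‖ * ‖ξ - u n‖ * ‖ξ - u n‖ := by gcongr; exact (π (a - d)).le_opNorm _
      _ ≤ ‖a - d₀‖ * ‖ξ - u n‖ * ‖ξ - u n‖ := by
        gcongr
        refine (NonUnitalStarAlgHom.norm_apply_le π _).trans ?_
        exact CStarAlgebra.norm_le_norm_of_nonneg_of_le (sub_nonneg.mpr (ha.1 hd))
          (sub_le_sub_left hd₀d a)
      _ = _ := by ring
  linarith

open scoped ComplexOrder in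
/-- The positive functional `b ↦ ⟨ξ, π(b) ξ⟩`. -/
def vectorFunctional (π : B →⋆ₙₐ[ℂ] (H →L[ℂ] H)) (ξ : H) : B →ₚ[ℂ] ℂ :=
  PositiveLinearMap.mk₀
    { toFun := fun b => inner ℂ ξ (π b ξ)
      map_add' := fun b c => by rw [map_add, add_apply, inner_add_right]
      map_smul' := fun c b => by
        rw [map_smul, smul_apply, inner_smul_right, RingHom.id_apply, smul_eq_mul] }
    fun b hb => by
      obtain ⟨c, rfl⟩ := CStarAlgebra.nonneg_iff_eq_star_mul_self.mp hb
      change 0 ≤ inner ℂ ξ (π (star c * c) ξ)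
      rw [map_mul, map_star, mul_apply_eq_comp, ContinuousLinearMap.star_eq_adjoint,
        ContinuousLinearMap.adjoint_inner_right, inner_self_eq_norm_sq_to_K]
      exact pow_nonneg ((RCLike.ofReal_nonneg (K := ℂ)).mpr (norm_nonneg _)) 2

open scoped ComplexOrder in
lemma vectorFunctional_apply (π : B →⋆ₙₐ[ℂ] (H →L[ℂ] H)) (ξ : H) (b : B) :
    vectorFunctional π ξ b = inner ℂ ξ (π b ξ) := rfl

open scoped ComplexOrder in
lemma IsNormalVector.scottContinuous {π : B →⋆ₙₐ[ℂ] (H →L[ℂ] H)} {ξ : H}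
    (hξ : IsNormalVector π ξ) : ScottContinuous (vectorFunctional π ξ) :=
  fun D hne hdir a ha => by
    have hmono : ∀ d ∈ D, vectorFunctional π ξ d ≤ vectorFunctional π ξ a := fun d hd =>
      OrderHomClass.mono (vectorFunctional π ξ) (ha.1 hd)
    refine ⟨?_, fun c hc => ?_⟩
    · rintro _ ⟨d, hd, rfl⟩
      exact hmono d hd
    · have hc' : ∀ d ∈ D, vectorFunctional π ξ d ≤ c := fun d hd => hc ⟨d, hd, rfl⟩
      obtain ⟨d₀, hd₀⟩ := hne
      rw [Complex.le_def]
      refine ⟨le_of_forall_pos_le_add fun ε hε => ?_, ?_⟩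
      · obtain ⟨d, hd, hlt⟩ := hξ ⟨d₀, hd₀⟩ hdir ha ε hε
        have h1 := (Complex.le_def.mp (hc' d hd)).1
        have h2 : (inner ℂ (π (a - d) ξ) ξ).re =
            (vectorFunctional π ξ a).re - (vectorFunctional π ξ d).re := by
          rw [vectorFunctional_apply, vectorFunctional_apply, ← Complex.sub_re, ← inner_sub_right,
            ← sub_apply, ← map_sub]
          exact inner_re_symm (𝕜 := ℂ) _ _
        linarith
      -- Comparable complex numbers have equal imaginary parts, so one element `d₀` settles this
      -- half.
      · rw [← (Complex.le_def.mp (hc' d₀ hd₀)).2, (Complex.le_def.mp (hmono d₀ hd₀)).2]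

/-- The normal functional of a normal vector. -/
def IsNormalVector.functional {π : B →⋆ₙₐ[ℂ] (H →L[ℂ] H)} {ξ : H}
    (hξ : IsNormalVector π ξ) : NormalFunctional B := ⟨vectorFunctional π ξ, hξ.scottContinuous⟩

lemma continuous_normalFunctional (ω : NormalFunctional B) :
    @Continuous B ℂ (weakStarTopology B) _ fun b => ω.1 b :=
  continuous_iInf_dom (i := ω) continuous_induced_dom

/-- A normal functional vanishing on a set with weak-⋆ dense span is zero. -/
lemma normalFunctional_eq_zero {G : Set B}
    (hG : @Dense B (weakStarTopology B) (Submodule.span ℂ G : Set B))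
    (ω : NormalFunctional B) (h : ∀ g ∈ G, ω.1 g = 0) (b : B) : ω.1 b = 0 := by
  have hspan : ∀ g ∈ Submodule.span ℂ G, ω.1 g = 0 := fun g hg => by
    induction hg using Submodule.span_induction with
    | mem x hx => exact h x hx
    | zero => exact map_zero ω.1
    | add x y _ _ hx hy => rw [map_add, hx, hy, add_zero]
    | smul c x _ hx => rw [map_smul, hx, smul_zero]
  exact congrFun (@Continuous.ext_on ℂ B _ (weakStarTopology B) _ _ hG _ _
    (continuous_normalFunctional ω) (@continuous_const B ℂ (weakStarTopology B) _ 0) hspan) b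

/-- A weak-⋆ dense span acts nondegenerately in a normal representation. -/
lemma rep_one_mem_closure {G : Set B}
    (hG : @Dense B (weakStarTopology B) (Submodule.span ℂ G : Set B))
    {π : B →⋆ₙₐ[ℂ] (H →L[ℂ] H)} (hπ : ∀ ξ, IsNormalVector π ξ) (k : H) :
    π 1 k ∈ (Submodule.span ℂ {v | ∃ g ∈ G, ∃ ξ, π g ξ = v}).topologicalClosure := by
  -- If `ζ` is orthogonal to all `π(g) ξ`, its vector functional vanishes on `G`, hence by normality
  -- on `1`. Therefore `π(1) ζ = 0`, and `ζ` is orthogonal to the range of the projection `π(1)`.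
  rw [← Submodule.orthogonal_orthogonal_eq_closure, Submodule.mem_orthogonal]
  intro ζ hζ
  rw [Submodule.mem_orthogonal] at hζ
  have h1 : inner ℂ ζ (π 1 ζ) = 0 := normalFunctional_eq_zero hG (hπ ζ).functional (fun g hg => by
    change inner ℂ ζ (π g ζ) = 0
    rw [← inner_conj_symm, hζ _ (Submodule.subset_span ⟨g, hg, ζ, rfl⟩), map_zero]) 1
  have h2 : π 1 ζ = 0 := by
    have := inner_rep_eq_norm_sq π 1 ζ
    rw [star_one, one_mul, ← inner_conj_symm, h1, map_zero, Complex.zero_re] at this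
    simpa using this.symm
  have h3 : inner ℂ ζ (π 1 k) = inner ℂ (π 1 ζ) k := by
    conv_rhs => rw [← star_one B, map_star, ContinuousLinearMap.star_eq_adjoint,
      ContinuousLinearMap.adjoint_inner_left]
  rw [h3, h2, inner_zero_left]

end Normal

/-! ### Normality passes to induced representations. -/

section NormalInd

variable {A B E H : Type*} [CStarAlgebra A] [PartialOrder A] [StarOrderedRing A]
  [CStarAlgebra B] [PartialOrder B] [StarOrderedRing B]
  [NormedAddCommGroup E] [NormedSpace ℂ E] [Module A E] [Module Bᵐᵒᵖ E]
  [RightHilbertModule B E] [WStarCorrespondence A B E]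
  [NormedAddCommGroup H] [InnerProductSpace ℂ H] [CompleteSpace H]
  {σ : B →⋆ₙₐ[ℂ] (H →L[ℂ] H)}

/-- Representations induced from normal ones are normal. -/
lemma isNormalVector_indRep (hσ : ∀ h, IsNormalVector σ h) (ξ : Ind E σ) :
    IsNormalVector (indRep A E σ) ξ := by
  induction ξ using ind_induction with
  | hp => exact isClosed_isNormalVector _
  | ih u =>
    induction u using pre_induction with
    | h0 =>
      intro D hne hdir a ha ε hε
      obtain ⟨d, hd⟩ := hne
      exact ⟨d, hd, by simpa using hε⟩
    | ha u v hu hv => rw [map_add]; exact hu.add hv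
    | ht x h =>
      intro D hne hdir a ha ε hε
      -- On `x ⊗ h` the form of `a` is `⟨h, σ⟨x, a x⟩ h⟩`. Normality of the left action makes `⟨x, a
      -- x⟩` the supremum of the directed set of all `⟨x, d x⟩`, to which normality of `h` applies.
      have hn := WStarCorrespondence.normal (A := A) (B := B) x
      have hdir' : DirectedOn (· ≤ ·) ((fun a : A => (ip x (a • x) : B)) '' D) := by
        rintro _ ⟨y, hy, rfl⟩ _ ⟨z, hz, rfl⟩
        obtain ⟨w, hw, hyw, hzw⟩ := hdir y hy z hz
        exact ⟨_, ⟨w, hw, rfl⟩, hn.monotone hyw, hn.monotone hzw⟩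
      obtain ⟨_, ⟨d, hd, rfl⟩, hlt⟩ := hσ h (hne.image _) hdir' (hn hne hdir ha) ε hε
      refine ⟨d, hd, ?_⟩
      have h1 : (ip x ((a - d) • x) : B) = ip x (a • x) - ip x (d • x) := by
        rw [sub_smul]; exact map_sub (ipₛₗ B E x) _ _
      change (inner ℂ (indRep A E σ (a - d) (tmul σ x h)) (tmul σ x h)).re < ε
      rw [← inner_conj_symm, indRep_tmul, inner_tmul_tmul, h1, inner_conj_symm]
      exact hlt

end NormalInd

/-! ### Norm estimates -/

/-- The Cauchy–Schwarz inequality in a C⋆-algebra. -/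
lemma norm_sq_le_of_forall_nonneg {A : Type*} [CStarAlgebra A] [PartialOrder A]
    [StarOrderedRing A] {p q r : A} (hp : 0 ≤ p)
    (h : ∀ b, 0 ≤ star b * p * b - star b * r - star r * b + q) : ‖r‖ ^ 2 ≤ ‖p‖ * ‖q‖ := by
  -- A number `t` strictly above `‖p‖` can be inverted even when `p = 0`; the bound for `‖p‖` itself
  -- follows by letting `t` decrease.
  have key : ∀ t, ‖p‖ < t → ‖r‖ ^ 2 ≤ t * ‖q‖ := fun t ht => by
    have ht0 : 0 < t := (norm_nonneg p).trans_lt ht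
    have h1 : p ≤ algebraMap ℝ A t :=
      (IsSelfAdjoint.le_algebraMap_norm_self hp.isSelfAdjoint).trans
        (algebraMap_mono A ht.le)
    have h2 : 0 ≤ star r * (algebraMap ℝ A t - p) * r :=
      star_left_conjugate_nonneg (sub_nonneg.mpr h1) r
    have h3 : star r * r ≤ t • q := by
      -- Taking `b = t⁻¹ r` in the hypothesis and multiplying by `t` leaves a term `t⁻¹ r⋆ p r`,
      -- which the added term `t⁻¹ r⋆ (t - p) r` cancels; the sum is `t q - r⋆ r`.
      have h4 := add_nonneg (smul_nonneg ht0.le (h (t⁻¹ • r)))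
        (smul_nonneg (inv_nonneg.mpr ht0.le) h2)
      rw [← sub_nonneg]
      refine h4.trans_eq ?_
      simp only [star_smul, star_trivial, smul_sub, smul_add, smul_mul_assoc, mul_smul_comm,
        mul_sub, sub_mul, smul_smul, Algebra.algebraMap_eq_smul_one, mul_one,
        inv_mul_cancel₀ ht0.ne', mul_inv_cancel₀ ht0.ne', one_smul]
      rw [show t * (t⁻¹ * t⁻¹) = t⁻¹ by rw [← mul_assoc, mul_inv_cancel₀ ht0.ne', one_mul]]
      abel
    have h5 := CStarAlgebra.norm_le_norm_of_nonneg_of_le (star_mul_self_nonneg r) h3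
    rwa [CStarRing.norm_star_mul_self, ← sq, norm_smul, Real.norm_of_nonneg ht0.le] at h5
  refine le_of_forall_pos_le_add fun ε hε => ?_
  have hq : 0 < ‖q‖ + 1 := by positivity
  refine (key (‖p‖ + ε / (‖q‖ + 1)) (lt_add_of_pos_right _ (by positivity))).trans ?_
  rw [add_mul]
  gcongr
  rw [div_mul_eq_mul_div, div_le_iff₀ hq]
  nlinarith [norm_nonneg q]

section Basic

variable {B E : Type*} [CStarAlgebra B] [PartialOrder B] [StarOrderedRing B]
  [NormedAddCommGroup E] [NormedSpace ℂ E] [Module Bᵐᵒᵖ E] [RightHilbertModule B E]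

lemma ip_sub_right (x y z : E) : (ip x (y - z) : B) = ip x y - ip x z :=
  map_sub (ipₛₗ B E x) y z

lemma ip_sub_left (x y z : E) : (ip (x - y) z : B) = ip x z - ip y z := by
  rw [← star_ip z (x - y), ip_sub_right, star_sub, star_ip, star_ip]

lemma norm_ip_le (x y : E) : ‖(ip x y : B)‖ ≤ ‖x‖ * ‖y‖ := by
  have h := norm_sq_le_of_forall_nonneg (p := (ip x x : B)) (q := ip y y) (r := ip x y)
    (RightHilbertModule.ip_self_nonneg x) fun b => by
      refine (RightHilbertModule.ip_self_nonneg (x <• b - y)).trans_eq ?_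
      rw [ip_sub_right, ip_sub_left, ip_sub_left, ip_op_smul_left, ip_op_smul_left,
        ip_op_smul_right, ip_op_smul_right, star_ip, mul_assoc]
      abel
  rw [← RightHilbertModule.norm_sq_eq, ← RightHilbertModule.norm_sq_eq, ← mul_pow] at h
  exact le_of_sq_le_sq h (by positivity)

end Basic

/-! ### The left action is contractive. -/

section Action

variable {A B E : Type*} [CStarAlgebra A] [PartialOrder A] [StarOrderedRing A]
  [CStarAlgebra B] [PartialOrder B] [StarOrderedRing B]
  [NormedAddCommGroup E] [NormedSpace ℂ E] [Module A E] [Module Bᵐᵒᵖ E]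
  [RightHilbertModule B E] [WStarCorrespondence A B E]

lemma ip_act_right (a : A) (x y : E) : (ip x (a • y) : B) = ip (star a • x) y := by
  rw [WStarCorrespondence.ip_act_left, star_star]

lemma norm_act_le {A : Type*} (B : Type*) {E : Type*} [CStarAlgebra A] [PartialOrder A]
    [StarOrderedRing A] [CStarAlgebra B] [PartialOrder B] [StarOrderedRing B]
    [NormedAddCommGroup E] [NormedSpace ℂ E] [Module A E] [Module Bᵐᵒᵖ E]
    [RightHilbertModule B E] [WStarCorrespondence A B E] (a : A) (x : E) : ‖a • x‖ ≤ ‖a‖ * ‖x‖ := by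
  refine le_mul_of_sq (norm_nonneg _) (norm_nonneg _) ?_
  have h1 : star a * a ≤ algebraMap ℝ A (‖a‖ ^ 2) := CStarAlgebra.star_mul_le_algebraMap_norm_sq
  obtain ⟨c, hc⟩ := CStarAlgebra.nonneg_iff_eq_star_mul_self.mp (sub_nonneg.mpr h1)
  -- With `‖a‖² - a⋆ a = c⋆ c`, the difference of the two sides is `⟨c x, c x⟩`.
  have h2 : (ip (a • x) (a • x) : B) ≤ ((‖a‖ ^ 2 : ℝ) : ℂ) • ip x x := by
    rw [← sub_nonneg]
    refine (RightHilbertModule.ip_self_nonneg (c • x)).trans_eq ?_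
    rw [WStarCorrespondence.ip_act_left, ← mul_smul, ← hc, sub_smul, ip_sub_right, mul_smul,
      ← WStarCorrespondence.ip_act_left, IsScalarTower.algebraMap_apply ℝ ℂ A,
      Algebra.algebraMap_eq_smul_one, WStarCorrespondence.smul_smul_complex (B := B), one_smul,
      ip_smul_right]
    rfl
  have h3 := CStarAlgebra.norm_le_norm_of_nonneg_of_le
    (RightHilbertModule.ip_self_nonneg (a • x)) h2
  rw [norm_smul, ← RightHilbertModule.norm_sq_eq, ← RightHilbertModule.norm_sq_eq,
    Complex.norm_real, Real.norm_of_nonneg (by positivity)] at h3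
  exact h3

end Action

/-! ### The `A`-valued inner product of an equivalence bimodule. -/

namespace EquivalenceBimodule

variable {A B X : Type*} [CStarAlgebra A] [PartialOrder A] [StarOrderedRing A]
  [CStarAlgebra B] [PartialOrder B] [StarOrderedRing B]
  [NormedAddCommGroup X] [NormedSpace ℂ X] [Module A X] [Module Bᵐᵒᵖ X]
  [RightHilbertModule B X] [WStarCorrespondence A B X] (hX : EquivalenceBimodule A B X)

lemma lip_add_right (x y z : X) : hX.lip x (y + z) = hX.lip x y + hX.lip x z := by
  rw [← hX.star_lip, hX.lip_add_left, star_add, hX.star_lip, hX.star_lip]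

lemma lip_smul_right (c : ℂ) (x y : X) : hX.lip x (star c • y) = c • hX.lip x y := by
  rw [← hX.star_lip, hX.lip_smul_left, star_smul, star_star, hX.star_lip]

lemma lip_act_right (a : A) (x y : X) : hX.lip x (star a • y) = hX.lip x y * a := by
  rw [← hX.star_lip, hX.lip_act_left, star_mul, star_star, hX.star_lip]

lemma lip_neg_left (x y : X) : hX.lip (-x) y = -hX.lip x y := by
  rw [← neg_one_smul ℂ x, hX.lip_smul_left, neg_one_smul]

lemma lip_neg_right (x y : X) : hX.lip x (-y) = -hX.lip x y := by
  rw [← hX.star_lip, lip_neg_left, star_neg, hX.star_lip]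

lemma norm_lip_le (x y : X) : ‖hX.lip x y‖ ≤ ‖x‖ * ‖y‖ := by
  have h := norm_sq_le_of_forall_nonneg (p := hX.lip x x) (q := hX.lip y y) (r := hX.lip x y)
    (hX.lip_self_nonneg x) fun b => by
      refine (hX.lip_self_nonneg (star b • x + -y)).trans_eq ?_
      rw [hX.lip_add_left, hX.lip_add_right, hX.lip_add_right, hX.lip_neg_left, hX.lip_neg_left,
        hX.lip_neg_right, hX.lip_neg_right, hX.lip_act_right, hX.lip_act_right, hX.lip_act_left,
        hX.lip_act_left, hX.star_lip]
      abel
  rw [← hX.norm_sq_eq_lip, ← hX.norm_sq_eq_lip, ← mul_pow] at h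
  exact le_of_sq_le_sq h (by positivity)

end EquivalenceBimodule

/-! ### Elementary tensors in `E ⊗_σ H` -/

section Creation

variable {B E H : Type*} [CStarAlgebra B] [PartialOrder B] [StarOrderedRing B]
  [NormedAddCommGroup E] [NormedSpace ℂ E] [Module Bᵐᵒᵖ E] [RightHilbertModule B E]
  [NormedAddCommGroup H] [InnerProductSpace ℂ H] [CompleteSpace H]
  (σ : B →⋆ₙₐ[ℂ] (H →L[ℂ] H))

lemma tmul_sub_left (x y : E) (h : H) : tmul σ (x - y) h = tmul σ x h - tmul σ y h := by
  simp [tmul]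

lemma tmul_add_right (x : E) (h k : H) : tmul σ x (h + k) = tmul σ x h + tmul σ x k := by
  simp [tmul]

lemma tmul_smul_right (c : ℂ) (x : E) (h : H) : tmul σ x (c • h) = c • tmul σ x h := by
  simp [tmul]

variable {σ} in
lemma ext_inner_tmul {ξ ζ : Ind E σ}
    (h : ∀ x k, inner ℂ ξ (tmul σ x k) = inner ℂ ζ (tmul σ x k)) : ξ = ζ := by
  have : innerSL ℂ ξ = innerSL ℂ ζ := ind_ext σ h
  exact ext_inner_right ℂ fun v => DFunLike.congr_fun this v

/-- The tensor product is taken over `ℂ`, but the semi-inner product already identifies the two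
sides, so they agree in the Hausdorff completion: `E ⊗_σ H` is automatically balanced over `B`. -/
lemma tmul_op_smul (x : E) (b : B) (h : H) : tmul σ (x <• b) h = tmul σ x (σ b h) := by
  refine ext_inner_tmul fun y k => ?_
  rw [inner_tmul_tmul, inner_tmul_tmul, ip_op_smul_left, map_mul, map_star, mul_apply_eq_comp,
    ContinuousLinearMap.star_eq_adjoint, ContinuousLinearMap.adjoint_inner_right]

lemma norm_tmul_sq (x : E) (h : H) : ‖tmul σ x h‖ ^ 2 = (inner ℂ h (σ (ip x x) h)).re := by
  rw [← inner_tmul_tmul]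
  exact norm_sq_eq_re_inner (𝕜 := ℂ) _

lemma norm_tmul_le (x : E) (h : H) : ‖tmul σ x h‖ ≤ ‖x‖ * ‖h‖ := by
  refine le_mul_of_sq (norm_nonneg _) (norm_nonneg _) ?_
  rw [norm_tmul_sq]
  calc (inner ℂ h (σ (ip x x) h)).re ≤ ‖h‖ * ‖σ (ip x x) h‖ :=
        (Complex.re_le_norm _).trans (norm_inner_le_norm _ _)
    _ ≤ ‖h‖ * (‖(ip x x : B)‖ * ‖h‖) := by
        gcongr
        exact ((σ (ip x x)).le_opNorm h).trans
          (by gcongr; exact NonUnitalStarAlgHom.norm_apply_le σ _)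
    _ = _ := by rw [← RightHilbertModule.norm_sq_eq]; ring

/-- The operator `H → E ⊗_σ H`, `h ↦ x ⊗ h`. -/
def creation (x : E) : H →L[ℂ] Ind E σ :=
  LinearMap.mkContinuous
    { toFun := tmul σ x
      map_add' := tmul_add_right σ x
      map_smul' := fun c h => tmul_smul_right σ c x h } ‖x‖ (norm_tmul_le σ x)

@[simp]
lemma creation_apply (x : E) (h : H) : creation σ x h = tmul σ x h := rfl

lemma adjoint_creation_tmul (x y : E) (h : H) :
    ContinuousLinearMap.adjoint (creation σ x) (tmul σ y h) = σ (ip x y) h := by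
  refine ext_inner_left ℂ fun k => ?_
  rw [ContinuousLinearMap.adjoint_inner_right, creation_apply, inner_tmul_tmul]

variable {σ} in
/-- A closed subspace containing the elementary tensors is everything. -/
lemma eq_top_of_tmul_mem {M : Submodule ℂ (Ind E σ)} (hM : IsClosed (M : Set (Ind E σ)))
    (h : ∀ x k, tmul σ x k ∈ M) : M = ⊤ := by
  refine (Submodule.eq_top_iff').mpr fun ξ => ?_
  induction ξ using ind_induction with
  | hp => exact hM
  | ih u =>
    induction u using pre_induction with
    | h0 => rw [map_zero]; exact M.zero_mem
    | ht x k => exact h x k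
    | ha u v hu hv => rw [map_add]; exact M.add_mem hu hv

lemma adjoint_indIsom_comp {M : Type*} [NormedAddCommGroup M] [InnerProductSpace ℂ M]
    [CompleteSpace M]
    (f : E →ₗ[ℂ] H →ₗ[ℂ] M)
    (hf : ∀ x h y k, inner ℂ (f x h) (f y k) = inner ℂ h (σ (ip x y) k)) :
    ContinuousLinearMap.adjoint (indIsom σ f hf) ∘L indIsom σ f hf =
      ContinuousLinearMap.id ℂ (Ind E σ) := by
  refine ind_ext σ fun y k => ?_
  refine ext_inner_tmul fun x h => ?_
  rw [ContinuousLinearMap.comp_apply, ContinuousLinearMap.adjoint_inner_left, indIsom_tmul,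
    indIsom_tmul, hf, ContinuousLinearMap.id_apply, inner_tmul_tmul]

lemma norm_indLift_apply_le {M : Type*} [NormedAddCommGroup M] [NormedSpace ℂ M] [CompleteSpace M]
    (f : E →ₗ[ℂ] H →ₗ[ℂ] M) (C : ℝ) (hC : ∀ u, ‖preLift σ f u‖ ≤ C * ‖u‖) (ξ : Ind E σ) :
    ‖indLift σ f C hC ξ‖ ≤ C * ‖ξ‖ := by
  induction ξ using ind_induction with
  | hp => exact isClosed_le (by fun_prop) (by fun_prop)
  | ih u => rw [indLift_toInd, LinearIsometry.norm_map]; exact hC u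

variable {σ} in
lemma norm_indMap_apply_le {K : Type*} [NormedAddCommGroup K] [InnerProductSpace ℂ K]
    [CompleteSpace K] {ρ : B →⋆ₙₐ[ℂ] (K →L[ℂ] K)} (η : K →L[ℂ] H)
    (hη : ∀ b, η ∘L ρ b = σ b ∘L η) (ξ : Ind E ρ) : ‖indMap E η hη ξ‖ ≤ ‖η‖ * ‖ξ‖ :=
  norm_indLift_apply_le _ _ _ _ ξ

end Creation

/-! ### The canonical isometries are unitaries -/

section Tensor

variable {C A B E X Z H : Type*}
  [CStarAlgebra C] [PartialOrder C] [StarOrderedRing C]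
  [CStarAlgebra A] [PartialOrder A] [StarOrderedRing A]
  [CStarAlgebra B] [PartialOrder B] [StarOrderedRing B]
  [NormedAddCommGroup E] [NormedSpace ℂ E] [Module C E] [Module Aᵐᵒᵖ E]
  [RightHilbertModule A E] [WStarCorrespondence C A E]
  [NormedAddCommGroup X] [NormedSpace ℂ X] [Module A X] [Module Bᵐᵒᵖ X]
  [RightHilbertModule B X] [WStarCorrespondence A B X]
  [NormedAddCommGroup Z] [NormedSpace ℂ Z] [Module C Z] [Module Bᵐᵒᵖ Z]
  [RightHilbertModule B Z] [WStarCorrespondence C B Z]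
  [NormedAddCommGroup H] [InnerProductSpace ℂ H] [CompleteSpace H]
  {t : E →ₗ[ℂ] X →ₗ[ℂ] Z} (ht : IsWStarTensor C A B t) {σ : B →⋆ₙₐ[ℂ] (H →L[ℂ] H)}

namespace IsWStarTensor

lemma norm_tmul_le (ht : IsWStarTensor C A B t)
    (e : E) (x : X) : ‖t e x‖ ≤ ‖e‖ * ‖x‖ := by
  refine le_mul_of_sq (norm_nonneg _) (norm_nonneg _) ?_
  rw [RightHilbertModule.norm_sq_eq (B := B), ht.ip_tmul]
  calc ‖(ip x ((ip e e : A) • x) : B)‖ ≤ ‖x‖ * ‖(ip e e : A) • x‖ := norm_ip_le _ _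
    _ ≤ ‖x‖ * (‖(ip e e : A)‖ * ‖x‖) := by gcongr; exact norm_act_le B _ _
    _ = _ := by rw [← RightHilbertModule.norm_sq_eq]; ring

/-- The operators `x ↦ e ⊗ x` are adjointable. -/
lemma exists_contract (ht : IsWStarTensor C A B t)
    (e : E) (z : Z) : ∃ w : X, ∀ x, (ip x w : B) = ip (t e x) z := by
  obtain ⟨w, hw⟩ := WStarCorrespondence.selfDual (A := A) (B := B) (E := X)
    (((ipₛₗ B Z z).comp (t e)).mkContinuous (‖z‖ * ‖e‖) fun x => by
      refine (norm_ip_le z (t e x)).trans ?_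
      rw [mul_assoc]
      gcongr
      exact ht.norm_tmul_le e x)
    (fun x b => by
      change (ip z (t e (x <• b)) : B) = ip z (t e x) * b
      rw [ht.act_right, ip_op_smul_right])
  refine ⟨w, fun x => ?_⟩
  rw [← star_ip w x, ← star_ip z (t e x), ← hw]
  rfl

/-- The adjoint of `x ↦ e ⊗ x`. -/
def contract (e : E) (z : Z) : X := (ht.exists_contract e z).choose

lemma ip_contract (e : E) (z : Z) (x : X) : (ip x (ht.contract e z) : B) = ip (t e x) z :=
  (ht.exists_contract e z).choose_spec x

lemma contract_add (e e' : E) (z : Z) :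
    ht.contract (e + e') z = ht.contract e z + ht.contract e' z :=
  ext_ip B fun x => by
    rw [ip_add_right, ht.ip_contract, ht.ip_contract, ht.ip_contract, map_add,
      LinearMap.add_apply, ip_add_left]

lemma contract_smul (c : ℂ) (e : E) (z : Z) :
    ht.contract (c • e) z = star c • ht.contract e z :=
  ext_ip B fun x => by
    rw [ip_smul_right, ht.ip_contract, ht.ip_contract, map_smul, LinearMap.smul_apply,
      ip_smul_left]

lemma contract_op_smul (e : E) (a : A) (z : Z) :
    ht.contract (e <• a) z = star a • ht.contract e z :=
  ext_ip B fun x => by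
    rw [ip_act_right, ht.ip_contract, ht.ip_contract, ht.balanced, star_star]

lemma norm_contract_le (e : E) (z : Z) : ‖ht.contract e z‖ ≤ ‖e‖ * ‖z‖ := by
  have h : ‖ht.contract e z‖ ^ 2 ≤ ‖e‖ * ‖ht.contract e z‖ * ‖z‖ := by
    rw [RightHilbertModule.norm_sq_eq (B := B), ht.ip_contract]
    refine (norm_ip_le _ _).trans ?_
    gcongr
    exact ht.norm_tmul_le _ _
  rcases eq_or_lt_of_le (norm_nonneg (ht.contract e z)) with h0 | h0
  · rw [← h0]; positivity
  · nlinarith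

/-- Elements of `Z` with the same inner products with the tensors `e ⊗ x` agree in a normal
representation. -/
lemma tmul_congr (ht : IsWStarTensor C A B t)
    (hσ : ∀ h, IsNormalVector σ h) {z z' : Z}
    (hz : ∀ e x, (ip (t e x) z : B) = ip (t e x) z') (h : H) : tmul σ z h = tmul σ z' h := by
  let ω := (hσ h).functional
  -- The functional `y ↦ ω ⟨z - z', y⟩`, with `ω` the vector functional of `h`, is one of those
  -- defining the weak-⋆ topology of `Z`, so vanishing on elementary tensors forces it to vanish
  -- everywhere. Its value at `z - z'` is `‖(z - z') ⊗ h‖²`.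
  have hcont : @Continuous Z ℂ (moduleWeakStarTopology B Z) _ fun y => ω.1 (ip (z - z') y) :=
    continuous_iInf_dom (i := ω) (continuous_iInf_dom (i := z - z') continuous_induced_dom)
  have hspan : ∀ y ∈ Submodule.span ℂ {y | ∃ e x, t e x = y}, ω.1 (ip (z - z') y) = 0 := by
    intro y hy
    induction hy using Submodule.span_induction with
    | mem y hy =>
      obtain ⟨e, x, rfl⟩ := hy
      rw [← star_ip, ip_sub_right, hz, sub_self, star_zero, map_zero]
    | zero => rw [show (ip (z - z') (0 : Z) : B) = 0 from map_zero (ipₛₗ B Z _), map_zero]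
    | add x y _ _ hx hy => rw [ip_add_right, map_add, hx, hy, add_zero]
    | smul c x _ hx => rw [ip_smul_right, map_smul, hx, smul_zero]
  have hzero := congrFun (@Continuous.ext_on ℂ Z _ (moduleWeakStarTopology B Z) _ _ ht.dense _ _
    hcont (@continuous_const Z ℂ (moduleWeakStarTopology B Z) _ 0) hspan) (z - z')
  rw [← sub_eq_zero, ← tmul_sub_left, ← norm_eq_zero, ← sq_eq_zero_iff, norm_tmul_sq]
  change (ω.1 (ip (z - z') (z - z'))).re = 0
  rw [hzero, Complex.zero_re]

/-- The tensors `(e ⊗ x) ⊗ h` are total in `Z ⊗_σ H` if `E` is an equivalence bimodule. -/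
lemma tmul_total_of_left (ht : IsWStarTensor C A B t)
    (hE : EquivalenceBimodule C A E) (hσ : ∀ h, IsNormalVector σ h)
    {M : Submodule ℂ (Ind Z σ)} (hM : IsClosed (M : Set (Ind Z σ)))
    (hmem : ∀ e x h, tmul σ (t e x) h ∈ M) : M = ⊤ := by
  -- The element `ₐ⟨e, e'⟩` acts on `Z` like a rank one operator, sending `z` to `e ⊗ w` with `w`
  -- the contraction of `z` by `e'`. It therefore maps all of `Z ⊗_σ H` into `M`, and left fullness
  -- reaches every vector because the induced representation is unital.
  have hlip : ∀ e e' : E, ∀ ξ : Ind Z σ, indRep C Z σ (hE.lip e e') ξ ∈ M := fun e e' ξ => by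
    have htop : M.comap (indRep C Z σ (hE.lip e e')).toLinearMap = ⊤ := by
      refine eq_top_of_tmul_mem (hM.preimage (indRep C Z σ (hE.lip e e')).continuous)
        fun z h => ?_
      change indRep C Z σ (hE.lip e e') (tmul σ z h) ∈ M
      rw [indRep_tmul, ht.tmul_congr (z' := t e (ht.contract e' z)) hσ]
      · exact hmem _ _ _
      · intro e'' x
        rw [ip_act_right, hE.star_lip, ← ht.act_left, hE.lip_smul, ht.balanced, ht.ip_tmul,
          ip_act_right, star_ip, ht.ip_contract]
    exact (Submodule.eq_top_iff'.mp htop) ξ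
  refine Submodule.eq_top_iff'.mpr fun ξ => ?_
  have hone : indRep C Z σ 1 ξ = ξ := DFunLike.congr_fun (ind_ext σ (S := indRep C Z σ 1)
    (T := ContinuousLinearMap.id ℂ _) fun z h => by rw [indRep_tmul, one_smul]; rfl) ξ
  have h1 := rep_one_mem_closure hE.left_full (isNormalVector_indRep (A := C) (E := Z) hσ) ξ
  rw [hone] at h1
  refine Submodule.topologicalClosure_minimal _ (Submodule.span_le.mpr ?_) hM h1
  rintro _ ⟨_, ⟨e, e', rfl⟩, ζ, rfl⟩
  exact hlip e e' ζ

/-- Contracting `z` by `e` and pairing with `x` in `A` gives a bounded right module map `E → A`, and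
self-duality of `E` represents it by a vector `u`. The identity `w ⟨x, y⟩ = ₐ⟨w, x⟩ y` then shows
that `z ⟨x, y⟩` and `u ⊗ y` have the same inner products with elementary tensors. -/
lemma exists_tmul_eq (ht : IsWStarTensor C A B t)
    (hX : EquivalenceBimodule A B X) (hσ : ∀ h, IsNormalVector σ h) (z : Z)
    (x y : X) : ∃ u : E, ∀ h, tmul σ (z <• (ip x y : B)) h = tmul σ (t u y) h := by
  let f : E →ₗ[ℂ] A :=
    { toFun := fun e => hX.lip x (ht.contract e z)
      map_add' := fun e e' => by rw [ht.contract_add, hX.lip_add_right]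
      map_smul' := fun c e => by rw [ht.contract_smul, hX.lip_smul_right]; rfl }
  obtain ⟨u, hu⟩ := WStarCorrespondence.selfDual (A := C) (B := A) (E := E)
    (f.mkContinuous (‖x‖ * ‖z‖) fun e => by
      refine (hX.norm_lip_le x (ht.contract e z)).trans ?_
      rw [mul_assoc]
      gcongr
      rw [mul_comm]
      exact ht.norm_contract_le e z)
    (fun e a => by
      change hX.lip x (ht.contract (e <• a) z) = hX.lip x (ht.contract e z) * a
      rw [ht.contract_op_smul, hX.lip_act_right])
  have hu' : ∀ e, (ip e u : A) = hX.lip (ht.contract e z) x := fun e => by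
    rw [← star_ip, ← hu]
    exact hX.star_lip _ _
  refine ⟨u, ht.tmul_congr hσ fun e w => ?_⟩
  rw [ip_op_smul_right, ht.ip_tmul, hu', hX.lip_smul, ip_op_smul_right, ht.ip_contract]

/-- The tensors `(e ⊗ x) ⊗ h` are total in `Z ⊗_σ H` if `X` is an equivalence bimodule. -/
lemma tmul_total_of_right (ht : IsWStarTensor C A B t)
    (hX : EquivalenceBimodule A B X) (hσ : ∀ h, IsNormalVector σ h)
    {M : Submodule ℂ (Ind Z σ)} (hM : IsClosed (M : Set (Ind Z σ)))
    (hmem : ∀ e x h, tmul σ (t e x) h ∈ M) : M = ⊤ := by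
  refine eq_top_of_tmul_mem hM fun z h => ?_
  have h1 := rep_one_mem_closure hX.right_full hσ h
  -- By right fullness `σ(1) h` is a limit of sums of vectors `σ⟨x, y⟩ k`, and `z ⊗ σ⟨x, y⟩ k = z
  -- ⟨x, y⟩ ⊗ k` is an elementary tensor by `exists_tmul_eq`. Nothing is lost with `σ(1)`, since `z
  -- ⊗ σ(1) h = z ⊗ h`.
  have h2 : σ 1 h ∈ M.comap (creation σ z).toLinearMap := by
    refine Submodule.topologicalClosure_minimal _ (Submodule.span_le.mpr ?_)
      (hM.preimage (creation σ z).continuous) h1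
    rintro _ ⟨_, ⟨x, y, rfl⟩, k, rfl⟩
    change tmul σ z (σ (ip x y) k) ∈ M
    obtain ⟨u, hu⟩ := ht.exists_tmul_eq hX hσ z x y
    rw [← tmul_op_smul, hu]
    exact hmem _ _ _
  change tmul σ z (σ 1 h) ∈ M at h2
  rwa [← tmul_op_smul, MulOpposite.op_one, one_smul] at h2

end IsWStarTensor

lemma assocOp_act (σ : B →⋆ₙₐ[ℂ] (H →L[ℂ] H)) (c : C) (e : E) :
    assocOp ht σ (c • e) = indRep C Z σ c ∘L assocOp ht σ e :=
  ind_ext σ fun x h => by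
    rw [assocOp_tmul, ContinuousLinearMap.comp_apply, assocOp_tmul, indRep_tmul, ht.act_left]

lemma assocIsom_tmul_ind (σ : B →⋆ₙₐ[ℂ] (H →L[ℂ] H)) (e : E) (ξ : Ind X σ) :
    assocIsom ht σ (tmul (indRep A X σ) e ξ) = assocOp ht σ e ξ :=
  indIsom_tmul (indRep A X σ) (assocOpBilin ht σ) _ e ξ

lemma assocIsom_comp_indRep (σ : B →⋆ₙₐ[ℂ] (H →L[ℂ] H)) (c : C) :
    assocIsom ht σ ∘L indRep C E (indRep A X σ) c = indRep C Z σ c ∘L assocIsom ht σ :=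
  ind_ext _ fun e ξ => by
    rw [ContinuousLinearMap.comp_apply, ContinuousLinearMap.comp_apply, indRep_tmul,
      assocIsom_tmul_ind, assocIsom_tmul_ind, assocOp_act]
    rfl

lemma adjoint_assocIsom_comp (σ : B →⋆ₙₐ[ℂ] (H →L[ℂ] H)) :
    ContinuousLinearMap.adjoint (assocIsom ht σ) ∘L assocIsom ht σ =
      ContinuousLinearMap.id ℂ _ :=
  adjoint_indIsom_comp _ _ _

/-- An isometry onto a total set is a coisometry. -/
lemma comp_adjoint_of_total {K L : Type*} [NormedAddCommGroup K] [InnerProductSpace ℂ K]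
    [CompleteSpace K] [NormedAddCommGroup L] [InnerProductSpace ℂ L] [CompleteSpace L]
    {V : K →L[ℂ] L} (hV : ContinuousLinearMap.adjoint V ∘L V = ContinuousLinearMap.id ℂ K)
    (hM : ∀ M : Submodule ℂ L, IsClosed (M : Set L) → (∀ k, V k ∈ M) → M = ⊤) :
    V ∘L ContinuousLinearMap.adjoint V = ContinuousLinearMap.id ℂ L := by
  -- The vectors fixed by `V V⋆` form a closed subspace that contains the range of the isometry `V`.
  have := hM (LinearMap.eqLocus (V ∘L ContinuousLinearMap.adjoint V).toLinearMap
    (ContinuousLinearMap.id ℂ L).toLinearMap)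
    (isClosed_eq (V ∘L ContinuousLinearMap.adjoint V).continuous continuous_id) fun k => by
      change V ((ContinuousLinearMap.adjoint V ∘L V) k) = V k
      rw [hV]; rfl
  ext l
  exact Submodule.eq_top_iff'.mp this l

lemma assocIsom_comp_adjoint_of_left (hE : EquivalenceBimodule C A E)
    (hσ : ∀ h, IsNormalVector σ h) :
    assocIsom ht σ ∘L ContinuousLinearMap.adjoint (assocIsom ht σ) =
      ContinuousLinearMap.id ℂ _ :=
  comp_adjoint_of_total (adjoint_assocIsom_comp ht σ) fun M hM h =>
    ht.tmul_total_of_left hE hσ hM fun e x k => by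
      rw [← assocIsom_tmul ht]; exact h _

lemma assocIsom_comp_adjoint_of_right (hX : EquivalenceBimodule A B X)
    (hσ : ∀ h, IsNormalVector σ h) :
    assocIsom ht σ ∘L ContinuousLinearMap.adjoint (assocIsom ht σ) =
      ContinuousLinearMap.id ℂ _ :=
  comp_adjoint_of_total (adjoint_assocIsom_comp ht σ) fun M hM h =>
    ht.tmul_total_of_right hX hσ hM fun e x k => by
      rw [← assocIsom_tmul ht]; exact h _

end Tensor

/-! ### The unitary `W ⊗ I_H`. -/

section Iso

variable {A B Z₁ Z₂ H : Type*}
  [CStarAlgebra A] [PartialOrder A] [StarOrderedRing A]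
  [CStarAlgebra B] [PartialOrder B] [StarOrderedRing B]
  [NormedAddCommGroup Z₁] [NormedSpace ℂ Z₁] [Module A Z₁] [Module Bᵐᵒᵖ Z₁]
  [RightHilbertModule B Z₁] [WStarCorrespondence A B Z₁]
  [NormedAddCommGroup Z₂] [NormedSpace ℂ Z₂] [Module A Z₂] [Module Bᵐᵒᵖ Z₂]
  [RightHilbertModule B Z₂] [WStarCorrespondence A B Z₂]
  [NormedAddCommGroup H] [InnerProductSpace ℂ H] [CompleteSpace H]
  (W : CorrespondenceIso A B Z₁ Z₂) (σ : B →⋆ₙₐ[ℂ] (H →L[ℂ] H))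

lemma isoTensorId_tmul (z : Z₁) (h : H) :
    isoTensorId W σ (tmul σ z h) = tmul σ (W.toFun z) h :=
  indIsom_tmul σ _ _ z h

lemma isoTensorId_comp_indRep (a : A) :
    isoTensorId W σ ∘L indRep A Z₁ σ a = indRep A Z₂ σ a ∘L isoTensorId W σ :=
  ind_ext _ fun z h => by
    rw [ContinuousLinearMap.comp_apply, ContinuousLinearMap.comp_apply, indRep_tmul,
      isoTensorId_tmul, isoTensorId_tmul, W.map_act_left, indRep_tmul]

lemma adjoint_isoTensorId_comp :
    ContinuousLinearMap.adjoint (isoTensorId W σ) ∘L isoTensorId W σ =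
      ContinuousLinearMap.id ℂ _ :=
  adjoint_indIsom_comp _ _ _

lemma isoTensorId_comp_adjoint :
    isoTensorId W σ ∘L ContinuousLinearMap.adjoint (isoTensorId W σ) =
      ContinuousLinearMap.id ℂ _ :=
  comp_adjoint_of_total (adjoint_isoTensorId_comp W σ) fun M hM h =>
    eq_top_of_tmul_mem hM fun z k => by
      obtain ⟨y, rfl⟩ := W.toLinearEquiv.surjective z
      exact isoTensorId_tmul W σ y k ▸ h (tmul σ y k)

end Iso

/-! ### Intertwiners of induced representations -/

/-- For `c ≥ 0` and small `ε`, the contraction `c (ε² + c)⁻¹` is almost a left unit for all `j`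
with `j j⋆ ≤ c`. -/
lemma exists_approx_left_unit {B : Type*} [CStarAlgebra B] [PartialOrder B] [StarOrderedRing B]
    {c : B} (hc : 0 ≤ c) {ε : ℝ} (hε : 0 < ε) :
    ∃ g : B, IsSelfAdjoint g ∧ ‖g * c * g‖ ≤ 1 ∧
      ∀ j, j * star j ≤ c → ‖g * c * g * j - j‖ ≤ ε := by
  have hspec : ∀ s ∈ spectrum ℝ c, 0 ≤ s := fun s hs => spectrum_nonneg_of_nonneg hc hs
  have hpos : ∀ s ∈ spectrum ℝ c, 0 < ε ^ 2 + s := fun s hs => by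
    have := hspec s hs; positivity
  -- The witness is `g = (ε² + c)^(-1/2)`, so that `g c g = c (ε² + c)⁻¹`. The symmetric form
  -- matters later: `g (∑ ⟨zᵢ, zᵢ⟩) g` is again a sum of inner squares.
  let f : ℝ → ℝ := fun s => (√(ε ^ 2 + s))⁻¹
  have hfsq : ∀ s ∈ spectrum ℝ c, f s * s * f s = s / (ε ^ 2 + s) := fun s hs => by
    have h1 := Real.mul_self_sqrt (hpos s hs).le
    have h2 := (Real.sqrt_pos.mpr (hpos s hs)).ne'
    simp only [f]
    rw [eq_div_iff (hpos s hs).ne']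
    field_simp
    rw [sq √_, h1]
  have hf : ContinuousOn f (spectrum ℝ c) := by
    refine ContinuousOn.inv₀ (by fun_prop) fun s hs => ?_
    exact (Real.sqrt_pos.mpr (hpos s hs)).ne'
  have hfs : ContinuousOn (fun s => f s * s) (spectrum ℝ c) := hf.mul continuousOn_id
  have hfsf : ContinuousOn (fun s => f s * s * f s) (spectrum ℝ c) := hfs.mul hf
  have he : cfc f c * c * cfc f c = cfc (fun s => f s * s * f s) c := by
    rw [cfc_mul (fun s => f s * s) f c hfs hf, cfc_mul f (fun s => s) c hf, cfc_id' ℝ c]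
  have hd : 1 - cfc f c * c * cfc f c = cfc (fun s => 1 - f s * s * f s) c := by
    rw [he, cfc_sub (fun _ => 1) (fun s => f s * s * f s) c continuousOn_const hfsf,
      cfc_const_one ℝ c]
  have hdc : ContinuousOn (fun s => 1 - f s * s * f s) (spectrum ℝ c) :=
    continuousOn_const.sub hfsf
  refine ⟨cfc f c, cfc_predicate f c, ?_, fun j hj => ?_⟩
  · rw [he]
    refine norm_cfc_le zero_le_one fun s hs => ?_
    have h0 := hspec s hs
    rw [hfsq s hs, Real.norm_of_nonneg (div_nonneg h0 (hpos s hs).le), div_le_one (hpos s hs)]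
    nlinarith
  · set d : B := 1 - cfc f c * c * cfc f c with hdef
    have hdsa : star d = d := by rw [hd]; exact cfc_predicate (R := ℝ) _ c
    -- Since `d = ε² (ε² + c)⁻¹`, the spectral function is `ε⁴ s / (ε² + s)²`, which is at most `ε²`
    -- for `s ≥ 0`. The hypothesis `j j⋆ ≤ c` gives `‖d j‖² ≤ ‖d c d‖`.
    have h1 : ‖d * c * d‖ ≤ ε ^ 2 := by
      have : d * c * d = cfc (fun s => (1 - f s * s * f s) * s * (1 - f s * s * f s)) c := by
        rw [cfc_mul (fun s => (1 - f s * s * f s) * s) _ c (hdc.mul continuousOn_id) hdc,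
          cfc_mul _ (fun s => s) c hdc, cfc_id' ℝ c, ← hd]
      rw [this]
      refine norm_cfc_le (by positivity) fun s hs => ?_
      have h0 := hspec s hs
      have hp := hpos s hs
      have : (1 - f s * s * f s) * s * (1 - f s * s * f s) =
          ε ^ 2 * (ε ^ 2 * s / (ε ^ 2 + s) ^ 2) := by
        rw [hfsq s hs]; field_simp; ring
      rw [this, Real.norm_of_nonneg (by positivity)]
      refine mul_le_of_le_one_right (by positivity) ?_
      rw [div_le_one (by positivity)]
      nlinarith [mul_nonneg (sq_nonneg ε) h0, sq_nonneg (ε ^ 2), sq_nonneg s]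
    have h2 : d * j * star (d * j) ≤ d * c * d := by
      have := star_right_conjugate_le_conjugate hj d
      rwa [hdsa, show d * (j * star j) * d = d * j * star (d * j) by
        rw [star_mul, hdsa]; simp only [mul_assoc]] at this
    have h3 := CStarAlgebra.norm_le_norm_of_nonneg_of_le (mul_star_self_nonneg (d * j)) h2
    rw [CStarRing.norm_self_mul_star] at h3
    have h4 : cfc f c * c * cfc f c * j - j = -(d * j) := by
      rw [hdef, sub_mul, one_mul, neg_sub]
    rw [h4, norm_neg]
    nlinarith [norm_nonneg (d * j)]

section Commutant

variable {A B X H K : Type*}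
  [CStarAlgebra A] [PartialOrder A] [StarOrderedRing A]
  [CStarAlgebra B] [PartialOrder B] [StarOrderedRing B]
  [NormedAddCommGroup X] [NormedSpace ℂ X] [Module A X] [Module Bᵐᵒᵖ X]
  [RightHilbertModule B X] [WStarCorrespondence A B X]
  [NormedAddCommGroup H] [InnerProductSpace ℂ H] [CompleteSpace H]
  [NormedAddCommGroup K] [InnerProductSpace ℂ K] [CompleteSpace K]
  {σ : B →⋆ₙₐ[ℂ] (H →L[ℂ] H)} {ρ : B →⋆ₙₐ[ℂ] (K →L[ℂ] K)}
  (hX : EquivalenceBimodule A B X)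

lemma rep_one_apply_rep (σ : B →⋆ₙₐ[ℂ] (H →L[ℂ] H)) (b : B) (h : H) :
    σ 1 (σ b h) = σ b h := by
  rw [← mul_apply_eq_comp, ← map_mul, one_mul]

lemma rep_apply_rep_one (σ : B →⋆ₙₐ[ℂ] (H →L[ℂ] H)) (b : B) (h : H) :
    σ b (σ 1 h) = σ b h := by
  rw [← mul_apply_eq_comp, ← map_mul, mul_one]

lemma norm_rep_apply_le (σ : B →⋆ₙₐ[ℂ] (H →L[ℂ] H)) (b : B) (h : H) :
    ‖σ b h‖ ≤ ‖b‖ * ‖h‖ :=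
  ((σ b).le_opNorm h).trans (by gcongr; exact NonUnitalStarAlgHom.norm_apply_le σ b)

lemma norm_rep_one_sq (σ : B →⋆ₙₐ[ℂ] (H →L[ℂ] H)) (h : H) :
    ‖σ 1 h‖ ^ 2 = (inner ℂ h (σ 1 h)).re := by
  have := inner_rep_eq_norm_sq σ 1 h
  rw [star_one, one_mul] at this
  rw [← this]
  exact inner_re_symm (𝕜 := ℂ) _ _

/-- The product is `⟨x, ₐ⟨y, y⟩ x⟩`; writing the positive element `ₐ⟨y, y⟩` as `s⋆ s` gives `w = s
x`. This replaces the generators `⟨x, y⟩` by inner squares that dominate them. -/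
lemma exists_ip_self_eq (hX : EquivalenceBimodule A B X)
    (x y : X) :
    ∃ w : X, (ip x y : B) * star (ip x y) = ip w w := by
  obtain ⟨s, hs⟩ := CStarAlgebra.nonneg_iff_eq_star_mul_self.mp (hX.lip_self_nonneg y)
  refine ⟨s • x, ?_⟩
  rw [WStarCorrespondence.ip_act_left, ← mul_smul, ← hs, hX.lip_smul, ip_op_smul_right, star_ip]

/-- There are contractions of the form `∑ ⟨wᵢ, wᵢ⟩` that approximate `1` strongly. -/
lemma exists_sum_ip_approx (hX : EquivalenceBimodule A B X)
    (hσ : ∀ h, IsNormalVector σ h) (v : H) {δ : ℝ} (hδ : 0 < δ) :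
    ∃ (n : ℕ) (w : Fin n → X), ‖∑ i, (ip (w i) (w i) : B)‖ ≤ 1 ∧
      ‖σ (∑ i, ip (w i) (w i)) v - σ 1 v‖ ≤ δ := by
  have hmem := rep_one_mem_closure hX.right_full hσ v
  obtain ⟨u, hu, hdist⟩ := Metric.mem_closure_iff.mp hmem (δ / 3) (by positivity)
  obtain ⟨n, a, m, hsum⟩ := Submodule.mem_span_set'.mp hu
  choose g hg ξ hξ using fun i => (m i).2
  choose x y hxy using hg
  choose z hz using fun i => exists_ip_self_eq hX (x i) (y i)
  let S : ℝ := ∑ i, ‖a i‖ * ‖ξ i‖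
  have hS : 0 ≤ S := Finset.sum_nonneg fun i _ => by positivity
  -- The error on `u = ∑ aᵢ σ(gᵢ) ξᵢ` is at most `ε S`, hence at most `δ / 3`; the summand `1`
  -- covers `S = 0`.
  let ε : ℝ := δ / 3 / (S + 1)
  have hc : (0 : B) ≤ ∑ i, ip (z i) (z i) :=
    Finset.sum_nonneg fun i _ => RightHilbertModule.ip_self_nonneg _
  obtain ⟨q, hqsa, hq1, hq⟩ := exists_approx_left_unit hc (ε := ε) (by positivity)
  have he : ∑ i, (ip (z i <• q) (z i <• q) : B) = q * (∑ i, ip (z i) (z i)) * q := by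
    rw [Finset.mul_sum, Finset.sum_mul]
    refine Finset.sum_congr rfl fun i _ => ?_
    rw [ip_op_smul_right, ip_op_smul_left, hqsa.star_eq]
  refine ⟨n, fun i => z i <• q, by rw [he]; exact hq1, ?_⟩
  rw [he]
  set e : B := q * (∑ i, ip (z i) (z i)) * q with hedef
  have h1 : ‖σ e u - u‖ ≤ δ / 3 := by
    have h2 : σ e u - u = ∑ i, a i • σ (e * g i - g i) (ξ i) := by
      rw [← hsum, map_sum, ← Finset.sum_sub_distrib]
      refine Finset.sum_congr rfl fun i _ => ?_
      rw [map_smul, ← smul_sub, ← hξ, map_sub, sub_apply, map_mul σ e (g i), mul_apply_eq_comp]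
    rw [h2]
    calc ‖∑ i, a i • σ (e * g i - g i) (ξ i)‖
        ≤ ∑ i, ‖a i • σ (e * g i - g i) (ξ i)‖ := norm_sum_le _ _
      _ ≤ ∑ i, ε * (‖a i‖ * ‖ξ i‖) := Finset.sum_le_sum fun i _ => by
          rw [norm_smul]
          have h3 : ‖e * g i - g i‖ ≤ ε := hq _ <| by
            rw [← hxy i, hz i]
            exact Finset.single_le_sum (f := fun i => (ip (z i) (z i) : B))
              (fun i _ => RightHilbertModule.ip_self_nonneg _) (Finset.mem_univ i)
          have h4 := (norm_rep_apply_le σ (e * g i - g i) (ξ i)).trans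
            (mul_le_mul_of_nonneg_right h3 (norm_nonneg _))
          calc ‖a i‖ * ‖σ (e * g i - g i) (ξ i)‖ ≤ ‖a i‖ * (ε * ‖ξ i‖) := by gcongr
            _ = _ := by ring
      _ = ε * S := (Finset.mul_sum _ _ _).symm
      _ ≤ δ / 3 := by
          rw [div_mul_eq_mul_div, div_le_iff₀ (by positivity)]
          nlinarith
  have h5 : ‖σ 1 v - u‖ ≤ δ / 3 := by rw [← dist_eq_norm]; exact hdist.le
  have h6 : ‖σ e (σ 1 v - u)‖ ≤ δ / 3 := by
    refine (norm_rep_apply_le σ _ _).trans ?_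
    calc ‖e‖ * ‖σ 1 v - u‖ ≤ 1 * (δ / 3) := by gcongr
      _ = _ := one_mul _
  -- Of the three differences, the outer two are small because `u` is near `σ(1) v` and `‖e‖ ≤ 1`,
  -- the middle one because `e` almost fixes every `gᵢ`.
  have h7 : σ e v - σ 1 v = σ e (σ 1 v - u) + (σ e u - u) - (σ 1 v - u) := by
    rw [map_sub, rep_apply_rep_one]; abel
  rw [h7]
  refine (norm_sub_le _ _).trans ?_
  linarith [norm_add_le (σ e (σ 1 v - u)) (σ e u - u)]

/-- If an operator acts as `k ↦ v` in the second tensor factor, then it controls `v` by `k`. -/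
lemma norm_le_of_tmul_eq (hX : EquivalenceBimodule A B X)
    (hσ : ∀ h, IsNormalVector σ h) (T : Ind X ρ →L[ℂ] Ind X σ) {k : K}
    {v : H} (hT : ∀ x, T (tmul ρ x k) = tmul σ x v) : ‖σ 1 v‖ ≤ ‖T‖ * ‖k‖ := by
  -- With `e = ∑ ⟨wᵢ, wᵢ⟩`, one has `⟨v, σ(e) v⟩ = ∑ ‖wᵢ ⊗ v‖²`, and `T` compares this term by term
  -- with `⟨k, ρ(e) k⟩ ≤ ‖k‖²`. As `e` approximates the unit, the left side approaches `‖σ(1) v‖²`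
  -- with error `δ ‖v‖`.
  have key : ∀ δ : ℝ, 0 < δ → ‖σ 1 v‖ ^ 2 ≤ (‖T‖ * ‖k‖) ^ 2 + δ * ‖v‖ := fun δ hδ => by
    obtain ⟨n, w, hw1, hw⟩ := exists_sum_ip_approx hX hσ v hδ
    have hsum : (inner ℂ v (σ (∑ i, ip (w i) (w i)) v)).re = ∑ i, ‖tmul σ (w i) v‖ ^ 2 := by
      simp only [norm_tmul_sq, map_sum, sum_apply, inner_sum, Complex.re_sum]
    have hsum' : (inner ℂ k (ρ (∑ i, ip (w i) (w i)) k)).re = ∑ i, ‖tmul ρ (w i) k‖ ^ 2 := by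
      simp only [norm_tmul_sq, map_sum, sum_apply, inner_sum, Complex.re_sum]
    have h1 : (inner ℂ v (σ (∑ i, ip (w i) (w i)) v)).re ≤ (‖T‖ * ‖k‖) ^ 2 := by
      calc (inner ℂ v (σ (∑ i, ip (w i) (w i)) v)).re
          = ∑ i, ‖tmul σ (w i) v‖ ^ 2 := hsum
        _ ≤ ∑ i, ‖T‖ ^ 2 * ‖tmul ρ (w i) k‖ ^ 2 := Finset.sum_le_sum fun i _ => by
            rw [← hT, ← mul_pow]
            gcongr
            exact T.le_opNorm _
        _ = ‖T‖ ^ 2 * (inner ℂ k (ρ (∑ i, ip (w i) (w i)) k)).re := by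
            rw [hsum', Finset.mul_sum]
        _ ≤ ‖T‖ ^ 2 * (‖k‖ * (1 * ‖k‖)) := by
            gcongr
            refine (Complex.re_le_norm _).trans ((norm_inner_le_norm _ _).trans ?_)
            gcongr
            exact (norm_rep_apply_le ρ _ _).trans (by gcongr)
        _ = _ := by ring
    have h2 : (inner ℂ v (σ 1 v - σ (∑ i, ip (w i) (w i)) v)).re ≤ δ * ‖v‖ := by
      refine (Complex.re_le_norm _).trans ((norm_inner_le_norm _ _).trans ?_)
      rw [norm_sub_rev, mul_comm]
      gcongr
    rw [inner_sub_right, Complex.sub_re, ← norm_rep_one_sq] at h2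
    linarith
  refine le_of_sq_le_sq (le_of_forall_pos_le_add fun ε hε => ?_) (by positivity)
  refine (key (ε / (‖v‖ + 1)) (by positivity)).trans ?_
  gcongr
  rw [div_mul_eq_mul_div, div_le_iff₀ (by positivity)]
  nlinarith [norm_nonneg v]

/-- The rank one operators `ₐ⟨x, y⟩` act on `X ⊗_σ H` as `ξ ↦ x ⊗ (y ⊗ ·)⋆ ξ`. -/
lemma indRep_lip (σ : B →⋆ₙₐ[ℂ] (H →L[ℂ] H)) (x y : X) :
    indRep A X σ (hX.lip x y) =
      creation σ x ∘L ContinuousLinearMap.adjoint (creation σ y) :=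
  ind_ext σ fun z h => by
    rw [indRep_tmul, hX.lip_smul, tmul_op_smul, ContinuousLinearMap.comp_apply,
      adjoint_creation_tmul, creation_apply]

/-- The operators intertwining the actions of `A` on `X ⊗_ρ K` and `X ⊗_σ H` are the operators
`I_X ⊗ η` with `η` intertwining `ρ` and `σ`. -/
theorem exists_eq_indMap (hX : EquivalenceBimodule A B X)
    (hρ : ∀ k, IsNormalVector ρ k) (hσ : ∀ h, IsNormalVector σ h)
    (T : Ind X ρ →L[ℂ] Ind X σ) (hT : ∀ a, T ∘L indRep A X ρ a = indRep A X σ a ∘L T) :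
    ∃ (η : K →L[ℂ] H) (hη : ∀ b, η ∘L ρ b = σ b ∘L η), T = indMap X η hη := by
  -- `D` is the domain on which `T` visibly has the form `I_X ⊗ η`. Since `x ⊗ v` depends only on
  -- `σ(1) v`, the normalization `σ(1) v = v` is what makes `v` unique.
  let D : Submodule ℂ K :=
    { carrier := {k | ∃ v, σ 1 v = v ∧ ∀ x, T (tmul ρ x k) = tmul σ x v}
      zero_mem' := ⟨0, map_zero _, fun x => by
        rw [← creation_apply, ← creation_apply, map_zero, map_zero, map_zero]⟩
      add_mem' := by
        rintro k k' ⟨v, hv, h⟩ ⟨v', hv', h'⟩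
        exact ⟨v + v', by rw [map_add, hv, hv'], fun x => by
          rw [tmul_add_right, tmul_add_right, map_add, h, h']⟩
      smul_mem' := by
        rintro c k ⟨v, hv, h⟩
        exact ⟨c • v, by rw [map_smul, hv], fun x => by
          rw [tmul_smul_right, tmul_smul_right, map_smul, h]⟩ }
  have hbound : ∀ k v, σ 1 v = v → (∀ x, T (tmul ρ x k) = tmul σ x v) → ‖v‖ ≤ ‖T‖ * ‖k‖ :=
    fun k v hv h => by
      have := norm_le_of_tmul_eq hX hσ T h
      rwa [hv] at this
  have hsub : ∀ {k k' v v'}, σ 1 v = v → σ 1 v' = v' → (∀ x, T (tmul ρ x k) = tmul σ x v) →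
      (∀ x, T (tmul ρ x k') = tmul σ x v') → ‖v - v'‖ ≤ ‖T‖ * ‖k - k'‖ :=
    fun {k k' v v'} hv hv' h h' => hbound _ _ (by rw [map_sub, hv, hv']) fun x => by
      rw [← creation_apply, ← creation_apply, map_sub, map_sub, map_sub, creation_apply,
        creation_apply, creation_apply, creation_apply, h, h']
  -- The a priori bound makes `k ↦ v` Lipschitz, so the chosen vectors `v` form a Cauchy sequence
  -- along any convergent sequence in `D`.
  have hclosed : IsClosed (D : Set K) := by
    rw [← isSeqClosed_iff_isClosed]
    intro k k₀ hk hlim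
    choose v hv h using hk
    have hcau : CauchySeq v := by
      rw [Metric.cauchySeq_iff']
      intro ε hε
      obtain ⟨N, hN⟩ := Metric.cauchySeq_iff'.mp hlim.cauchySeq (ε / (‖T‖ + 1)) (by positivity)
      refine ⟨N, fun n hn => ?_⟩
      have h1 := hN n hn
      rw [dist_eq_norm] at h1 ⊢
      rw [lt_div_iff₀ (by positivity)] at h1
      refine (hsub (hv n) (hv N) (h n) (h N)).trans_lt ?_
      nlinarith [norm_nonneg (k n - k N)]
    obtain ⟨v₀, hv₀⟩ := cauchySeq_tendsto_of_complete hcau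
    refine ⟨v₀, ?_, fun x => ?_⟩
    · refine tendsto_nhds_unique (((σ 1).continuous.tendsto v₀).comp hv₀) (hv₀.congr fun n => ?_)
      exact (hv n).symm
    · refine tendsto_nhds_unique
        (((T ∘L creation ρ x).continuous.tendsto k₀).comp hlim)
        ((((creation σ x).continuous.tendsto v₀).comp hv₀).congr fun n => ?_)
      exact (h n x).symm
  have htop : ∀ k, k ∈ D := by
    intro k
    have h1 : ρ 1 k ∈ D := by
      refine Submodule.topologicalClosure_minimal _ (Submodule.span_le.mpr ?_) hclosed
        (rep_one_mem_closure hX.right_full hρ k)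
      rintro _ ⟨_, ⟨x', x'', rfl⟩, ξ, rfl⟩
      -- From `x ⟨x', x''⟩ = ₐ⟨x, x'⟩ x''` and the commutation of `T` with `ₐ⟨x, x'⟩`, the vector `T
      -- (x ⊗ ρ⟨x', x''⟩ ξ)` equals `ₐ⟨x, x'⟩ T (x'' ⊗ ξ)`. By `indRep_lip` this is `x` tensored
      -- with a vector that does not involve `x`, which is the witness.
      refine ⟨ContinuousLinearMap.adjoint (creation σ x') (T (tmul ρ x'' ξ)), ?_, fun x => ?_⟩
      · refine ext_inner_left ℂ fun h => ?_
        have h2 : inner ℂ h (σ 1 (ContinuousLinearMap.adjoint (creation σ x') (T (tmul ρ x'' ξ))))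
            = inner ℂ (σ 1 h) (ContinuousLinearMap.adjoint (creation σ x') (T (tmul ρ x'' ξ))) := by
          conv_rhs => rw [← star_one B, map_star, ContinuousLinearMap.star_eq_adjoint,
            ContinuousLinearMap.adjoint_inner_left]
        rw [h2, ContinuousLinearMap.adjoint_inner_right, ContinuousLinearMap.adjoint_inner_right,
          creation_apply, creation_apply, ← tmul_op_smul, MulOpposite.op_one, one_smul]
      · rw [← tmul_op_smul, ← hX.lip_smul, ← indRep_tmul]
        refine (DFunLike.congr_fun (hT (hX.lip x x')) (tmul ρ x'' ξ)).trans ?_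
        rw [indRep_lip]
        rfl
    -- The part of `k` outside the range of `ρ(1)` is killed by every `x ⊗ ·`, so `η` is set to zero
    -- there.
    have h3 : k - ρ 1 k ∈ D := by
      refine ⟨0, map_zero _, fun x => ?_⟩
      rw [← creation_apply, ← creation_apply, map_sub, map_zero, creation_apply, creation_apply,
        ← tmul_op_smul, MulOpposite.op_one, one_smul, sub_self, map_zero]
    have := D.add_mem h3 h1
    rwa [sub_add_cancel] at this
  choose η hη1 hηT using htop
  have huniq : ∀ {k v}, σ 1 v = v → (∀ x, T (tmul ρ x k) = tmul σ x v) → η k = v := by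
    intro k v hv h
    have := hsub (hη1 k) hv (hηT k) h
    rw [sub_self, norm_zero, mul_zero] at this
    exact sub_eq_zero.mp (norm_eq_zero.mp (le_antisymm this (norm_nonneg _)))
  let η' : K →L[ℂ] H := LinearMap.mkContinuous
    { toFun := η
      map_add' := fun k k' => huniq (by rw [map_add, hη1, hη1]) fun x => by
        rw [tmul_add_right, tmul_add_right, map_add, hηT, hηT]
      map_smul' := fun c k => huniq (by rw [RingHom.id_apply, map_smul, hη1]) fun x => by
        rw [RingHom.id_apply, tmul_smul_right, tmul_smul_right, map_smul, hηT] }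
    ‖T‖ fun k => hbound k (η k) (hη1 k) (hηT k)
  have hη' : ∀ k, η' k = η k := fun _ => rfl
  have hint : ∀ b, η' ∘L ρ b = σ b ∘L η' := fun b => by
    ext k
    refine huniq (rep_one_apply_rep σ b _) fun x => ?_
    change T (tmul ρ x (ρ b k)) = tmul σ x (σ b (η k))
    rw [← tmul_op_smul, hηT, tmul_op_smul]
  exact ⟨η', hint, ind_ext ρ fun x k => by rw [indMap_tmul, hη', hηT]⟩

/-- `‖I_X ⊗ η‖ = ‖η‖`. -/
lemma norm_indMap (hX : EquivalenceBimodule A B X)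
    (hσ : ∀ h, IsNormalVector σ h) (η : K →L[ℂ] H)
    (hη : ∀ b, η ∘L ρ b = σ b ∘L η) (hρ : ρ 1 = 1) : ‖indMap X η hη‖ = ‖η‖ := by
  refine le_antisymm ?_ ?_
  · refine ContinuousLinearMap.opNorm_le_bound _ (norm_nonneg _) fun ξ => ?_
    exact norm_indMap_apply_le η hη ξ
  · refine ContinuousLinearMap.opNorm_le_bound _ (norm_nonneg _) fun k => ?_
    have h := norm_le_of_tmul_eq hX hσ (indMap X η hη) (k := k) fun x => indMap_tmul η hη x k
    -- The a priori bound controls only `σ(1) η k`; unitality of `ρ` and the intertwining relation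
    -- put `η k` in the range of `σ(1)`.
    have h1 : σ 1 (η k) = η k := by
      have := DFunLike.congr_fun (hη 1) k
      rw [hρ] at this
      exact this.symm
    rwa [h1] at h

end Commutant

/-! ### Isometric isomorphisms induce equivalences of the disc categories -/

section DiscEquiv

variable {V V₂ : Type*} [NormedAddCommGroup V] [NormedSpace ℂ V]
  [NormedAddCommGroup V₂] [NormedSpace ℂ V₂] (Φ : V ≃ₗᵢ[ℂ] V₂)

/-- The bijection of open unit discs given by an isometric isomorphism. -/
def discEquiv : Disc V ≃ Disc V₂ where
  toFun p := ⟨Φ p, by rw [mem_ball_zero_iff, Φ.norm_map]; exact mem_ball_zero_iff.mp p.2⟩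
  invFun p := ⟨Φ.symm p, by
    rw [mem_ball_zero_iff, Φ.symm.norm_map]; exact mem_ball_zero_iff.mp p.2⟩
  left_inv p := Subtype.ext (Φ.symm_apply_apply p)
  right_inv p := Subtype.ext (Φ.apply_symm_apply p)

lemma isHolomorphic_conj {g : Disc V → Disc V} (hg : IsHolomorphic g) :
    IsHolomorphic fun p => discEquiv Φ (g ((discEquiv Φ).symm p)) := by
  obtain ⟨G, hG, hGg⟩ := hg
  refine ⟨fun v => Φ (G (Φ.symm v)), ?_, fun p => ?_⟩
  · refine Φ.differentiable.comp_differentiableOn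
      (hG.comp Φ.symm.differentiable.differentiableOn fun v hv => ?_)
    simpa using hv
  · exact congrArg Φ (hGg ((discEquiv Φ).symm p))

/-- Conjugation of disc automorphisms by an isometric isomorphism. -/
def conjAut (g : discAut V) : discAut V₂ :=
  ⟨(discEquiv Φ).symm.trans (g.1.trans (discEquiv Φ)),
    isHolomorphic_conj Φ g.2.1, isHolomorphic_conj Φ g.2.2⟩

/-- This one identity supplies both the endpoint condition for `discFunctor` on morphisms and the
formula for the transformed automorphism at every point of the disc. -/
lemma conjAut_apply (g : discAut V) (p : Disc V) :
    (conjAut Φ g).1 (discEquiv Φ p) = discEquiv Φ (g.1 p) :=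
  congrArg (fun q => discEquiv Φ (g.1 q)) ((discEquiv Φ).symm_apply_apply p)

/-- The functor between disc categories given by an isometric isomorphism. -/
def discFunctor : DiscCat V ⥤ DiscCat V₂ where
  obj p := ⟨discEquiv Φ p.pt⟩
  map {p q} g := ⟨conjAut Φ g.aut, by rw [conjAut_apply, g.map_pt]⟩
  map_id p := DiscCat.Hom.ext (Subtype.ext (Equiv.ext fun v =>
    (discEquiv Φ).apply_symm_apply v))
  map_comp {p q r} g h := DiscCat.Hom.ext (Subtype.ext (Equiv.ext fun v =>
    congrArg (fun w => discEquiv Φ (h.aut.1 w))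
      ((discEquiv Φ).symm_apply_apply (g.aut.1 ((discEquiv Φ).symm v))).symm))

lemma conjAut_symm_conjAut (g : discAut V) : conjAut Φ.symm (conjAut Φ g) = g :=
  Subtype.ext (Equiv.ext fun p => by
    change (discEquiv Φ).symm (discEquiv Φ (g.1 ((discEquiv Φ).symm (discEquiv Φ p)))) = g.1 p
    rw [Equiv.symm_apply_apply, Equiv.symm_apply_apply])

lemma conjAut_conjAut_symm (g : discAut V₂) : conjAut Φ (conjAut Φ.symm g) = g :=
  conjAut_symm_conjAut Φ.symm g

instance : (discFunctor Φ).Faithful where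
  map_injective {p q} g h hgh := DiscCat.Hom.ext (by
    have := congrArg (fun k => conjAut Φ.symm (DiscCat.Hom.aut k)) hgh
    exact (conjAut_symm_conjAut Φ g.aut).symm.trans (this.trans (conjAut_symm_conjAut Φ h.aut)))

instance : (discFunctor Φ).Full where
  map_surjective {p q} g := by
    refine ⟨⟨conjAut Φ.symm g.aut, (discEquiv Φ).injective ?_⟩,
      DiscCat.Hom.ext (conjAut_conjAut_symm Φ g.aut)⟩
    rw [← conjAut_apply, conjAut_conjAut_symm]
    exact g.map_pt

instance : (discFunctor Φ).EssSurj where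
  mem_essImage p := ⟨⟨(discEquiv Φ).symm p.pt⟩, ⟨eqToIso (by
    change DiscCat.mk _ = p
    rw [Equiv.apply_symm_apply])⟩⟩

instance : (discFunctor Φ).IsEquivalence where

/-- A surjective linear isometry between subspaces induces an equivalence of their disc
categories. -/
lemma exists_discCat_equivalence (p : Submodule ℂ V) (q : Submodule ℂ V₂) (f : p → q)
    (hadd : ∀ v w, (f (v + w) : V₂) = f v + f w) (hsmul : ∀ (c : ℂ) v, (f (c • v) : V₂) = c • f v)
    (hnorm : ∀ v, ‖(f v : V₂)‖ = ‖(v : V)‖) (hsurj : Function.Surjective f) :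
    ∃ e : DiscCat p ≌ DiscCat q, (∀ r, (e.functor.obj r).pt = f r.pt) ∧
      ∀ (r s : DiscCat p) (g : r ⟶ s) (u : DiscCat p),
        (e.functor.map g).aut.1 (e.functor.obj u).pt = (e.functor.obj ⟨g.aut.1 u.pt⟩).pt := by
  let Φ : p ≃ₗᵢ[ℂ] q := LinearIsometryEquiv.ofSurjective
    { toFun := f
      map_add' := fun v w => Subtype.ext (hadd v w)
      map_smul' := fun c v => Subtype.ext (hsmul c v)
      norm_map' := hnorm } hsurj
  exact ⟨(discFunctor Φ).asEquivalence, fun _ => rfl, fun _ _ g u => conjAut_apply Φ g.aut u.pt⟩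

end DiscEquiv

/-! ### The transform is an isometric isomorphism -/

section Unitary

variable {K L : Type*} [NormedAddCommGroup K] [InnerProductSpace ℂ K] [CompleteSpace K]
  [NormedAddCommGroup L] [InnerProductSpace ℂ L] [CompleteSpace L]

/-- The operator `V` is a unitary that intertwines the representations `π` and `π'`. -/
structure IsUnitaryIntertwiner {A : Type*} [CStarAlgebra A] (π : A →⋆ₙₐ[ℂ] (K →L[ℂ] K))
    (π' : A →⋆ₙₐ[ℂ] (L →L[ℂ] L)) (V : K →L[ℂ] L) : Prop where
  adjoint_comp : ContinuousLinearMap.adjoint V ∘L V = ContinuousLinearMap.id ℂ K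
  comp_adjoint : V ∘L ContinuousLinearMap.adjoint V = ContinuousLinearMap.id ℂ L
  comp_rep : ∀ a, V ∘L π a = π' a ∘L V

namespace IsUnitaryIntertwiner

variable {A : Type*} [CStarAlgebra A] {π : A →⋆ₙₐ[ℂ] (K →L[ℂ] K)} {π' : A →⋆ₙₐ[ℂ] (L →L[ℂ] L)}
  {V : K →L[ℂ] L}

/-- The intertwining relation for the adjoint at `a` is the adjoint of the relation for `V` at `a⋆`.
-/
lemma adjoint (hV : IsUnitaryIntertwiner π π' V) :
    IsUnitaryIntertwiner π' π (ContinuousLinearMap.adjoint V) where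
  adjoint_comp := by rw [ContinuousLinearMap.adjoint_adjoint]; exact hV.comp_adjoint
  comp_adjoint := by rw [ContinuousLinearMap.adjoint_adjoint]; exact hV.adjoint_comp
  comp_rep a := by
    have h := congrArg ContinuousLinearMap.adjoint (hV.comp_rep (star a))
    rw [ContinuousLinearMap.adjoint_comp, ContinuousLinearMap.adjoint_comp, map_star π, map_star π',
      ContinuousLinearMap.star_eq_adjoint, ContinuousLinearMap.star_eq_adjoint,
      ContinuousLinearMap.adjoint_adjoint, ContinuousLinearMap.adjoint_adjoint] at h
    exact h.symm

lemma comp {M : Type*} [NormedAddCommGroup M] [InnerProductSpace ℂ M] [CompleteSpace M]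
    {π'' : A →⋆ₙₐ[ℂ] (M →L[ℂ] M)} {U : L →L[ℂ] M} (hU : IsUnitaryIntertwiner π' π'' U)
    (hV : IsUnitaryIntertwiner π π' V) : IsUnitaryIntertwiner π π'' (U ∘L V) where
  adjoint_comp := by
    rw [ContinuousLinearMap.adjoint_comp, ContinuousLinearMap.comp_assoc,
      ← ContinuousLinearMap.comp_assoc _ U V, hU.adjoint_comp, ContinuousLinearMap.id_comp,
      hV.adjoint_comp]
  comp_adjoint := by
    rw [ContinuousLinearMap.adjoint_comp, ContinuousLinearMap.comp_assoc,
      ← ContinuousLinearMap.comp_assoc V, hV.comp_adjoint, ContinuousLinearMap.id_comp,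
      hU.comp_adjoint]
  comp_rep a := by
    rw [ContinuousLinearMap.comp_assoc, hV.comp_rep, ← ContinuousLinearMap.comp_assoc,
      hU.comp_rep, ContinuousLinearMap.comp_assoc]

lemma norm_le_one (hV : IsUnitaryIntertwiner π π' V) : ‖V‖ ≤ 1 :=
  ContinuousLinearMap.opNorm_le_bound _ zero_le_one fun x => by
    rw [(ContinuousLinearMap.norm_map_iff_adjoint_comp_self V).mpr hV.adjoint_comp, one_mul]

lemma norm_comp_eq (hV : IsUnitaryIntertwiner π π' V) {M : Type*} [NormedAddCommGroup M]
    [InnerProductSpace ℂ M] (T : L →L[ℂ] M) : ‖T ∘L V‖ = ‖T‖ := by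
  refine le_antisymm ?_ ?_
  · exact (T.opNorm_comp_le V).trans (mul_le_of_le_one_right (norm_nonneg _) hV.norm_le_one)
  · calc ‖T‖ = ‖(T ∘L V) ∘L ContinuousLinearMap.adjoint V‖ := by
          rw [ContinuousLinearMap.comp_assoc, hV.comp_adjoint, ContinuousLinearMap.comp_id]
      _ ≤ ‖T ∘L V‖ * ‖ContinuousLinearMap.adjoint V‖ := ContinuousLinearMap.opNorm_comp_le _ _
      _ ≤ ‖T ∘L V‖ := mul_le_of_le_one_right (norm_nonneg _) hV.adjoint.norm_le_one

end IsUnitaryIntertwiner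

end Unitary

/-! ### The transform and its fixed unitary factor. -/

section Main

variable {A B E F X Z₁ Z₂ H : Type*}
  [CStarAlgebra A] [PartialOrder A] [StarOrderedRing A]
  [CStarAlgebra B] [PartialOrder B] [StarOrderedRing B]
  [NormedAddCommGroup E] [NormedSpace ℂ E] [Module A E] [Module Aᵐᵒᵖ E]
  [RightHilbertModule A E] [WStarCorrespondence A A E]
  [NormedAddCommGroup F] [NormedSpace ℂ F] [Module B F] [Module Bᵐᵒᵖ F]
  [RightHilbertModule B F] [WStarCorrespondence B B F]
  [NormedAddCommGroup X] [NormedSpace ℂ X] [Module A X] [Module Bᵐᵒᵖ X]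
  [RightHilbertModule B X] [WStarCorrespondence A B X]
  [NormedAddCommGroup Z₁] [NormedSpace ℂ Z₁] [Module A Z₁] [Module Bᵐᵒᵖ Z₁]
  [RightHilbertModule B Z₁] [WStarCorrespondence A B Z₁]
  [NormedAddCommGroup Z₂] [NormedSpace ℂ Z₂] [Module A Z₂] [Module Bᵐᵒᵖ Z₂]
  [RightHilbertModule B Z₂] [WStarCorrespondence A B Z₂]
  [NormedAddCommGroup H] [InnerProductSpace ℂ H] [CompleteSpace H]
  {t₁ : E →ₗ[ℂ] X →ₗ[ℂ] Z₁} (ht₁ : IsWStarTensor A A B t₁)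
  {t₂ : X →ₗ[ℂ] F →ₗ[ℂ] Z₂} (ht₂ : IsWStarTensor A B B t₂)
  (W : CorrespondenceIso A B Z₁ Z₂) {σ : B →⋆ₙₐ[ℂ] (H →L[ℂ] H)}

lemma indMap_comp_indRep {K : Type*} [NormedAddCommGroup K] [InnerProductSpace ℂ K]
    [CompleteSpace K] {ρ : B →⋆ₙₐ[ℂ] (K →L[ℂ] K)} (η : K →L[ℂ] H)
    (hη : ∀ b, η ∘L ρ b = σ b ∘L η) (a : A) :
    indMap X η hη ∘L indRep A X ρ a = indRep A X σ a ∘L indMap X η hη :=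
  ind_ext ρ fun x k => by
    rw [ContinuousLinearMap.comp_apply, ContinuousLinearMap.comp_apply, indRep_tmul,
      indMap_tmul, indMap_tmul, indRep_tmul]

lemma indRep_one (σ : B →⋆ₙₐ[ℂ] (H →L[ℂ] H)) : indRep A X σ 1 = 1 :=
  ind_ext σ fun x h => by rw [indRep_tmul, one_smul]; rfl

lemma intertwiners_comp (η : intertwiners F σ) (b : B) :
    η.1 ∘L indRep B F σ b = σ b ∘L η.1 := η.2 b

/-- This splits off the factor that does not depend on `η`, so linearity, norm and range can all be
read off from `I_X ⊗ η`. -/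
lemma transform_eq (η : intertwiners F σ) : transform ht₁ ht₂ W σ η =
    indMap X η.1 (intertwiners_comp η) ∘L
      (ContinuousLinearMap.adjoint (assocIsom ht₂ σ) ∘L isoTensorId W σ ∘L assocIsom ht₁ σ) :=
  rfl

/-- The canonical identification `E ⊗ (X ⊗_σ H) → X ⊗ (F ⊗_σ H)` given by `W` is unitary. -/
lemma isUnitaryIntertwiner_transport (hX : EquivalenceBimodule A B X)
    (hσ : ∀ h, IsNormalVector σ h) :
    IsUnitaryIntertwiner (indRep A E (indRep A X σ)) (indRep A X (indRep B F σ))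
      (ContinuousLinearMap.adjoint (assocIsom ht₂ σ) ∘L isoTensorId W σ ∘L assocIsom ht₁ σ) :=
  -- `X` is the left factor of `Z₂` and the right factor of `Z₁`, so the two associativity maps are
  -- surjective for different reasons: fullness of the `A`-valued inner product for the first,
  -- fullness of the `B`-valued one for the second.
  have h₂ : IsUnitaryIntertwiner (indRep A X (indRep B F σ)) (indRep A Z₂ σ) (assocIsom ht₂ σ) :=
    ⟨adjoint_assocIsom_comp ht₂ σ, assocIsom_comp_adjoint_of_left ht₂ hX hσ,
      assocIsom_comp_indRep ht₂ σ⟩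
  have hW : IsUnitaryIntertwiner (indRep A Z₁ σ) (indRep A Z₂ σ) (isoTensorId W σ) :=
    ⟨adjoint_isoTensorId_comp W σ, isoTensorId_comp_adjoint W σ, isoTensorId_comp_indRep W σ⟩
  have h₁ : IsUnitaryIntertwiner (indRep A E (indRep A X σ)) (indRep A Z₁ σ) (assocIsom ht₁ σ) :=
    ⟨adjoint_assocIsom_comp ht₁ σ, assocIsom_comp_adjoint_of_right ht₁ hX hσ,
      assocIsom_comp_indRep ht₁ σ⟩
  h₂.adjoint.comp (hW.comp h₁)

lemma transform_add (η ζ : intertwiners F σ) :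
    transform ht₁ ht₂ W σ (η + ζ) = transform ht₁ ht₂ W σ η + transform ht₁ ht₂ W σ ζ := by
  have : indMap X (η + ζ).1 (intertwiners_comp (η + ζ)) =
      indMap X η.1 (intertwiners_comp η) + indMap X ζ.1 (intertwiners_comp ζ) :=
    ind_ext _ fun x k => by
      rw [add_apply, indMap_tmul, indMap_tmul, indMap_tmul]
      exact tmul_add_right σ x _ _
  rw [transform_eq, this, ContinuousLinearMap.add_comp, transform_eq, transform_eq]

lemma transform_smul (c : ℂ) (η : intertwiners F σ) :
    transform ht₁ ht₂ W σ (c • η) = c • transform ht₁ ht₂ W σ η := by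
  have : indMap X (c • η).1 (intertwiners_comp (c • η)) =
      c • indMap X η.1 (intertwiners_comp η) :=
    ind_ext _ fun x k => by
      rw [smul_apply, indMap_tmul, indMap_tmul]
      exact tmul_smul_right σ c x _
  rw [transform_eq, this, ContinuousLinearMap.smul_comp, transform_eq]

/-- Composing with a unitary preserves the norm, and `I_X ⊗ η` has the norm of `η` because its
source representation, induced on `F ⊗_σ H`, is unital. -/
lemma norm_transform (hX : EquivalenceBimodule A B X)
    (hσ : ∀ h, IsNormalVector σ h) (η : intertwiners F σ) : ‖transform ht₁ ht₂ W σ η‖ = ‖η.1‖ := by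
  rw [transform_eq, (isUnitaryIntertwiner_transport ht₁ ht₂ W hX hσ).norm_comp_eq,
    norm_indMap hX hσ η.1 (intertwiners_comp η) (indRep_one σ)]

lemma transform_mem (hX : EquivalenceBimodule A B X)
    (hσ : ∀ h, IsNormalVector σ h) (η : intertwiners F σ) :
    transform ht₁ ht₂ W σ η ∈ intertwiners E (indRep A X σ) := fun a => by
  rw [transform_eq, ContinuousLinearMap.comp_assoc,
    (isUnitaryIntertwiner_transport ht₁ ht₂ W hX hσ).comp_rep,
    ← ContinuousLinearMap.comp_assoc, indMap_comp_indRep, ContinuousLinearMap.comp_assoc]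

/-- Undoing the unitary turns `S` into an operator `X ⊗ (F ⊗_σ H) → X ⊗_σ H` that commutes with `A`;
by the commutant theorem it is `I_X ⊗ η`, and the intertwining property of `η` is exactly membership
in the intertwining space of `F`. -/
lemma exists_transform_eq (hX : EquivalenceBimodule A B X)
    (hσ : ∀ h, IsNormalVector σ h) (S : intertwiners E (indRep A X σ)) :
    ∃ η : intertwiners F σ, transform ht₁ ht₂ W σ η = S.1 := by
  have hU := isUnitaryIntertwiner_transport ht₁ ht₂ W hX hσ
  obtain ⟨η, hη, h⟩ := exists_eq_indMap hX (isNormalVector_indRep (A := B) (E := F) hσ) hσ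
    (S.1 ∘L ContinuousLinearMap.adjoint (ContinuousLinearMap.adjoint (assocIsom ht₂ σ) ∘L
      isoTensorId W σ ∘L assocIsom ht₁ σ)) fun a => by
      rw [ContinuousLinearMap.comp_assoc, hU.adjoint.comp_rep, ← ContinuousLinearMap.comp_assoc,
        S.2 a, ContinuousLinearMap.comp_assoc]
  refine ⟨⟨η, hη⟩, ?_⟩
  rw [transform_eq, ← h, ContinuousLinearMap.comp_assoc, hU.adjoint_comp,
    ContinuousLinearMap.comp_id]

end Main

end WStarMorita

end

open WStarMorita CategoryTheory in
/-- Let `(E, A)` and `(F, B)` be W⋆-correspondences that are weakly Morita equivalent via the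
W⋆-equivalence bimodule `X` and the isomorphism `W : E ⊗ X → X ⊗ F` (W⋆-tensor products), and let
`σ` be a normal representation of `B` on `H`. Then `η^* ↦ (I_X ⊗ η^*)(W ⊗ I_H)` is the object map
of an equivalence of categories from `σ-Covrep F` to `σ^X-Covrep E`, which maps an automorphism
`g` to the automorphism `(I_X ⊗ ζ^*)(W ⊗ I_H) ↦ (I_X ⊗ g(ζ^*))(W ⊗ I_H)`. -/
theorem mainTheorem5 {A B E F X Z₁ Z₂ H : Type*}
    [CStarAlgebra A] [PartialOrder A] [StarOrderedRing A] [WStarAlgebra A]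
    [CStarAlgebra B] [PartialOrder B] [StarOrderedRing B] [WStarAlgebra B]
    [NormedAddCommGroup E] [NormedSpace ℂ E] [Module A E] [Module Aᵐᵒᵖ E]
    [RightHilbertModule A E] [WStarCorrespondence A A E]
    [NormedAddCommGroup F] [NormedSpace ℂ F] [Module B F] [Module Bᵐᵒᵖ F]
    [RightHilbertModule B F] [WStarCorrespondence B B F]
    [NormedAddCommGroup X] [NormedSpace ℂ X] [Module A X] [Module Bᵐᵒᵖ X]
    [RightHilbertModule B X] [WStarCorrespondence A B X] (_hX : EquivalenceBimodule A B X)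
    [NormedAddCommGroup Z₁] [NormedSpace ℂ Z₁] [Module A Z₁] [Module Bᵐᵒᵖ Z₁]
    [RightHilbertModule B Z₁] [WStarCorrespondence A B Z₁]
    (t₁ : E →ₗ[ℂ] X →ₗ[ℂ] Z₁) (ht₁ : IsWStarTensor A A B t₁)
    [NormedAddCommGroup Z₂] [NormedSpace ℂ Z₂] [Module A Z₂] [Module Bᵐᵒᵖ Z₂]
    [RightHilbertModule B Z₂] [WStarCorrespondence A B Z₂]
    (t₂ : X →ₗ[ℂ] F →ₗ[ℂ] Z₂) (ht₂ : IsWStarTensor A B B t₂)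
    (W : CorrespondenceIso A B Z₁ Z₂)
    [NormedAddCommGroup H] [InnerProductSpace ℂ H] [CompleteSpace H]
    (σ : B →⋆ₙₐ[ℂ] (H →L[ℂ] H)) (_hσ : ScottContinuous σ) :
    ∃ e : Covrep F σ ≌ Covrep E (indRep A X σ),
      (∀ η : Covrep F σ,
        ((e.functor.obj η).pt.1 : Ind E (indRep A X σ) →L[ℂ] Ind X σ) =
          transform ht₁ ht₂ W σ η.pt.1) ∧
      ∀ (η₁ η₂ : Covrep F σ) (g : η₁ ⟶ η₂) (ζ : Covrep F σ),
        (e.functor.map g).aut.1 (e.functor.obj ζ).pt =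
          (e.functor.obj ⟨g.aut.1 ζ.pt⟩).pt := by
  -- Normality of `σ` is used only through its vector functionals.
  have hσ : ∀ h, IsNormalVector σ h := isNormalVector_of_scottContinuous _hσ
  obtain ⟨e, hobj, hmap⟩ := exists_discCat_equivalence (intertwiners F σ)
    (intertwiners E (indRep A X σ))
    (fun η => ⟨transform ht₁ ht₂ W σ η, transform_mem ht₁ ht₂ W _hX hσ η⟩)
    (transform_add ht₁ ht₂ W) (transform_smul ht₁ ht₂ W) (norm_transform ht₁ ht₂ W _hX hσ)
    (fun S => (exists_transform_eq ht₁ ht₂ W _hX hσ S).imp fun _ h => Subtype.ext h)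
  exact ⟨e, fun η => congrArg Subtype.val (hobj η), hmap⟩
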